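/- \textbf{Setting.} Fix a radius $R>0$. For integers $k,d\ge 1$ let $$\mathcal G_{k,d}=\Big\{\Gamma=\sum_{j=1}^k w_j\delta_{\mu_j}:\ \mu_j\in\mathbb R^d,\ \|\mu_j\|_2\le R,\ w_j\ge 0,\ \sum_{j=1}^k w_j=1\Big\},\qquad P_\Gamma=\Gamma*N(0,I_d).$$ Let $H(P,Q)=\big(\int(\sqrt p-\sqrt q)^2\,d\mu\big)^{1/2}$ be the Hellinger distance ($p,q$ the densities with respect to a dominating measure $\mu$) and $W_1(\Gamma,\Gamma')=\inf\mathbb E\|U-U'\|_2$ the Wasserstein distance (infimum over all couplings $U\sim\Gamma$, $U'\sim\Gamma'$). An estimator of the mixing distribution is a measurable map from samples to $\mathcal G_{k,d}$; a proper density estimator is one of the form $\hat P=P_{\tilde\Gamma}$ with $\tilde\Gamma$ such a map. \textbf{Theorem.} There is a constant $C>0$ depending only on $R$ such that the following holds for all $k\ge1$ and $c_k>0$. For $d,n\ge 1$ write $$\rho(d,n)=(Ck)^{k/2}\sqrt{c_k}\Big(\frac dn\Big)^{1/4}+C\,k^{5}\,c_k^{\frac1{2k-1}}\Big(\frac1n\Big)^{\frac1{4k-2}}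 .$$ (a) Let $n\ge1$ and suppose that for each $d\ge1$ there is a proper density estimator $\hat P_d=P_{\tilde\Gamma_d}$ such that for every $\Gamma\in\mathcal G_{k,d}$ and $X_1,\dots,X_n\overset{\text{i.i.d.}}{\sim}P_\Gamma$, $$\mathbb E\,H\big(\hat P_d(X_1,\dots,X_n),P_\Gamma\big)\le c_k\sqrt{d/n}.\qquad(*)$$ Then for each $d\ge1$ there is an estimator $\hat\Gamma\in\mathcal G_{k,d}$ based on $X_1,\dots,X_{2n}\overset{\text{i.i.d.}}{\sim}P_\Gamma$ with $\mathbb E\,W_1(\hat\Gamma,\Gamma)\le\rho(d,n)$ for every $\Gamma\in\mathcal G_{k,d}$. It is built in two stages. With $r=\min(d,k)$, there is a $d\times r$ matrix $\hat V$ with orthonormal columns, a measurable function of $X_1,\dots,X_n$, whose column span contains the atoms of $\tilde\Gamma_d(X_1,\dots,X_n)$; and $\hat\Gamma$ is the image under $z\mapsto\hat Vz$ of $\hat\gamma=\tilde\Gamma_r(\hat V^\top X_{n+1},\dots,\hat V^\top X_{2n})$. (b) Suppose that such proper density estimators, satisfying $(*)$ with the same $c_k$, exist for all $d\ge1$ and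 all $n\ge1$. Then for all $n,d\ge1$ there is an estimator $\hat\Gamma\in\mathcal G_{k,d}$ based on $n$ observations $X_1,\dots,X_n\overset{\text{i.i.d.}}{\sim}P_\Gamma$ with $\mathbb E\,W_1(\hat\Gamma,\Gamma)\le\rho(d,n)$ for every $\Gamma\in\mathcal G_{k,d}$; for $n\ge2$ it is obtained by the two-stage construction of (a) from the density estimators for sample size $\lfloor n/2\rfloor$, applied to the first and the next $\lfloor n/2\rfloor$ observations. -/

import Mathlib

open MeasureTheory ProbabilityTheory
open scoped ENNReal

noncomputable section

/-- Euclidean space `ℝ^d`. -/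
abbrev Euc (d : ℕ) : Type := EuclideanSpace ℝ (Fin d)

/-- The class `G_{k,d}` of mixing distributions: `∑_{j ≤ k} w_j δ_{μ_j}` with `‖μ_j‖ ≤ R`,
`w_j ≥ 0`, `∑ w_j = 1` (atoms may coincide, weights may vanish). -/
def atomicMixing (k d : ℕ) (R : ℝ) : Set (Measure (Euc d)) :=
  {Γ | ∃ (w : Fin k → ℝ) (μ : Fin k → Euc d),
    (∀ j, ‖μ j‖ ≤ R) ∧ (∀ j, 0 ≤ w j) ∧ ∑ j, w j = 1 ∧
      Γ = ∑ j, ENNReal.ofReal (w j) • Measure.dirac (μ j)}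

/-- The Gaussian mixture `P_Γ = Γ * N(0, I_d)`. -/
def gaussMix {d : ℕ} (Γ : Measure (Euc d)) : Measure (Euc d) :=
  Γ.conv (stdGaussian (Euc d))

/-- The law of `n` i.i.d. observations from `P_Γ`. -/
def sampleLaw {d : ℕ} (n : ℕ) (Γ : Measure (Euc d)) : Measure (Fin n → Euc d) :=
  Measure.pi (fun _ : Fin n => gaussMix Γ)

/-- The Hellinger distance `(∫ (√p - √q)² dμ)^{1/2}`, with densities taken with respect to the
dominating measure `μ = P + Q`. -/
def hellinger {α : Type*} [MeasurableSpace α] (P Q : Measure α) : ℝ≥0∞ :=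
  (∫⁻ x, ENNReal.ofReal
    ((√(P.rnDeriv (P + Q) x).toReal - √(Q.rnDeriv (P + Q) x).toReal) ^ 2) ∂(P + Q)) ^ (1 / 2 : ℝ)

/-- The `1`-Wasserstein distance: the infimum of `E ‖U - U'‖` over all couplings. -/
def wasserstein1 {d : ℕ} (Γ Γ' : Measure (Euc d)) : ℝ≥0∞ :=
  ⨅ π ∈ {π : Measure (Euc d × Euc d) | π.map Prod.fst = Γ ∧ π.map Prod.snd = Γ'},
    ∫⁻ p, edist p.1 p.2 ∂π

/-- An estimator, from `n` observations in `ℝ^d`, of the mixing distribution, with values in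
`G_{k,d}`. The associated mixture `gaussMix (G X)` is a proper density estimator. -/
structure IsMixingEstimator (k d n : ℕ) (R : ℝ)
    (G : (Fin n → Euc d) → Measure (Euc d)) : Prop where
  measurable : Measurable G
  mem : ∀ X, G X ∈ atomicMixing k d R

/-- `gaussMix (G X)` is a proper density estimator, from `n` observations in `ℝ^d`, whose expected
Hellinger error is at most `c (d/n)^{1/2}`, uniformly over `G_{k,d}`. -/
structure IsProperDensityEstimator (k d n : ℕ) (R c : ℝ)
    (G : (Fin n → Euc d) → Measure (Euc d)) : Prop where
  estimator : IsMixingEstimator k d n R G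
  risk : ∀ Γ ∈ atomicMixing k d R,
    ∫⁻ X, hellinger (gaussMix (G X)) (gaussMix Γ) ∂(sampleLaw n Γ)
      ≤ ENNReal.ofReal (c * ((d : ℝ) / n) ^ (1 / 2 : ℝ))

/-- The right-hand side of the risk bound. -/
def mixingRate (C c : ℝ) (k d n : ℕ) : ℝ :=
  (C * k) ^ ((k : ℝ) / 2) * √c * ((d : ℝ) / n) ^ (1 / 4 : ℝ)
    + C * (k : ℝ) ^ 5 * c ^ (1 / (2 * (k : ℝ) - 1)) * (1 / (n : ℝ)) ^ (1 / (4 * (k : ℝ) - 2))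

/-- `E W₁(G, Γ)` is at most `b`, uniformly over `G_{k,d}`. -/
def HasW1Risk (k d n : ℕ) (R b : ℝ) (G : (Fin n → Euc d) → Measure (Euc d)) : Prop :=
  ∀ Γ ∈ atomicMixing k d R,
    ∫⁻ X, wasserstein1 (G X) Γ ∂(sampleLaw n Γ) ≤ ENNReal.ofReal b

/-- For a matrix `V` with columns `V j`, the vector `Vᵀ y`. -/
def projFrame {d r : ℕ} (V : Fin r → Euc d) (y : Euc d) : Euc r :=
  WithLp.toLp 2 (fun j => inner ℝ (V j) y)

/-- For a matrix `V` with columns `V j`, the vector `V z`. -/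
def liftFrame {d r : ℕ} (V : Fin r → Euc d) (z : Euc r) : Euc d :=
  ∑ j, z j • V j

/-- The first `m` observations. -/
def firstHalf {d m N : ℕ} (h : 2 * m ≤ N) (X : Fin N → Euc d) : Fin m → Euc d :=
  fun i => X ⟨i, by omega⟩

/-- The observations numbered `m + 1, …, 2 m`. -/
def secondHalf {d m N : ℕ} (h : 2 * m ≤ N) (X : Fin N → Euc d) : Fin m → Euc d :=
  fun i => X ⟨m + i, by omega⟩

/-- `G` is the two-stage estimator built from the `m`-sample density estimators
`gaussMix (F d' ·)`, `d' = 1, 2, …`. The density estimator in `ℝ^d` is applied to the first `m`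
observations, and `V` is an orthonormal frame of `r = min d k` vectors whose span contains the
atoms of the fitted mixing distribution. The next `m` observations are projected to `ℝ^r` by `Vᵀ`,
the density estimator in `ℝ^r` is applied to them, and the mixing distribution that it yields is
mapped back to `ℝ^d` by `V`. -/
def IsTwoStage (k : ℕ) {d m N : ℕ} (h : 2 * m ≤ N)
    (F : (d' : ℕ) → (Fin m → Euc d') → Measure (Euc d'))
    (G : (Fin N → Euc d) → Measure (Euc d)) : Prop :=
  ∃ V : (Fin m → Euc d) → Fin (min d k) → Euc d,
    Measurable V ∧
    (∀ x, Orthonormal ℝ (V x)) ∧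
    (∀ x, F d x ((Submodule.span ℝ (Set.range (V x)) : Set (Euc d))ᶜ) = 0) ∧
    ∀ X, G X = (F (min d k) (fun i => projFrame (V (firstHalf h X)) (secondHalf h X i))).map
      (liftFrame (V (firstHalf h X)))

end

/-!
The exponentials `y ↦ exp ⟪s, y⟫` are eigenfunctions of the Gaussian convolution, with eigenvalue
`exp (‖s‖² / 2)`. By Cauchy–Schwarz, two mixtures that are close in Hellinger distance therefore
have mixing distributions with close Laplace transforms, uniformly over `‖s‖ ≤ 1`.

*First stage.* The fitted mixing distribution lives on the span of the frame `V`, so along a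
direction `u` orthogonal to that span its Laplace transform is `1`. The elementary bound
`t² ≤ exp t + exp (-t) - 2` then controls the second moment of `Γ` along `u`, and with it the cost
of projecting `Γ` to the span.

*Second stage.* Conditionally on the first half of the sample, `Vᵀ X` is a sample from a mixture in
dimension `r ≤ k`, where the density estimator has a rate free of `d`. A random direction in `ℝ^r`
shrinks none of the at most `k²` differences between atoms of the two mixing distributions by more
than a power of `k`, which reduces the Wasserstein distance to the line. The Laplace transforms at
`m / (2 k)`, `m < 2 k`, are the first `2 k` moments of the images of the atoms under
`y ↦ exp (y / (2 k))`. Killing these at most `2 k` nodes one at a time bounds the difference of the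
two distribution functions in each gap between nodes, and the comonotone coupling turns this into
transport cost.

For a single observation there is no sample to split. Le Cam's two-point method bounds `c` from
below, so that the rate exceeds `R` and a constant estimator suffices.
-/

section GapsBetweenNodes

variable {ι : Type*} [Fintype ι]

theorem abs_sum_filter_le_abs_sum {s : ι → ℝ} {p : ι → Prop} [DecidablePred p]
    (h : (∀ i, s i ≠ 0 → p i) ∨ ∀ i, s i ≠ 0 → ¬ p i) :
    |∑ i with p i, s i| ≤ |∑ i, s i| := by
  rcases h with h | h
  · rw [Finset.sum_filter_of_ne fun i _ => h i]
  · rw [Finset.sum_eq_zero fun i hi => not_not.1 fun hs => h i hs (Finset.mem_filter.1 hi).2,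
      abs_zero]
    exact abs_nonneg _

theorem abs_sum_mul_sub_mul_pow_le {s y : ι → ℝ} {c δ K : ℝ} {m : ℕ} (hc : 1 + |c| ≤ K)
    (h : |∑ i, s i * y i ^ m| ≤ δ) (h' : |∑ i, s i * y i ^ (m + 1)| ≤ δ) :
    |∑ i, s i * (y i - c) * y i ^ m| ≤ δ * K := by
  have hδ : 0 ≤ δ := (abs_nonneg _).trans h
  have hsplit : ∑ i, s i * (y i - c) * y i ^ m
      = ∑ i, s i * y i ^ (m + 1) - c * ∑ i, s i * y i ^ m := by
    rw [Finset.mul_sum, ← Finset.sum_sub_distrib]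
    exact Finset.sum_congr rfl fun i _ => by ring
  calc |∑ i, s i * (y i - c) * y i ^ m|
      ≤ |∑ i, s i * y i ^ (m + 1)| + |c| * |∑ i, s i * y i ^ m| := by
        rw [hsplit, ← abs_mul]
        exact abs_sub _ _
    _ ≤ δ + |c| * δ := by gcongr
    _ = δ * (1 + |c|) := by ring
    _ ≤ δ * K := by gcongr

theorem card_mul_sub_ne_zero_lt {s y : ι → ℝ} {a : ι} (ha : s a ≠ 0) :
    Finset.card {i | s i * (y i - y a) ≠ 0} < Finset.card {i | s i ≠ 0} := by
  refine Finset.card_lt_card (Finset.ssubset_iff_of_subset ?_ |>.2 ⟨a, by simpa using ha, by simp⟩)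
  exact Finset.monotone_filter_right _ fun i _ => left_ne_zero_of_mul

/-- Multiplying the weights by `y - y a` annihilates a node `a` left of the gap, multiplying by
`y - y b` a node `b` right of it; the difference of the two products is `y b - y a ≥ g` times the
original weights. -/
theorem abs_sum_filter_le_of_abs_moments_le {y : ι → ℝ} {t g K : ℝ} (hg : 0 < g)
    (hgK : g ≤ 2 * K) (hK : ∀ i, 1 + |y i| ≤ K) (hgap : ∀ i j, y i ≤ t → t < y j → g ≤ y j - y i)
    {N : ℕ} {s : ι → ℝ} {δ : ℝ} (hcard : Finset.card {i | s i ≠ 0} ≤ N + 1)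
    (hm : ∀ m ≤ N, |∑ i, s i * y i ^ m| ≤ δ) :
    |∑ i with y i ≤ t, s i| ≤ δ * (2 * K / g) ^ N := by
  have hδ : 0 ≤ δ := (abs_nonneg _).trans (hm 0 (Nat.zero_le _))
  by_cases hside : (∀ i, s i ≠ 0 → y i ≤ t) ∨ ∀ i, s i ≠ 0 → ¬ y i ≤ t
  · have hm0 : |∑ i, s i| ≤ δ := by simpa using hm 0 (Nat.zero_le _)
    exact ((abs_sum_filter_le_abs_sum hside).trans hm0).trans
      (le_mul_of_one_le_right hδ (one_le_pow₀ ((one_le_div hg).2 hgK)))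
  push Not at hside
  obtain ⟨⟨b, hsb, hb⟩, a, hsa, ha⟩ := hside
  match N, hcard, hm with
  | 0, hcard, _ =>
    have hab : a = b := Finset.card_le_one.1 hcard a (by simpa using hsa) b (by simpa using hsb)
    exact absurd (hab ▸ ha) hb.not_ge
  | N + 1, hcard, hm =>
    have hstep : ∀ c, s c ≠ 0 →
        |∑ i with y i ≤ t, s i * (y i - y c)| ≤ δ * K * (2 * K / g) ^ N := fun c hc =>
      abs_sum_filter_le_of_abs_moments_le hg hgK hK hgap
        (Nat.lt_succ_iff.1 ((card_mul_sub_ne_zero_lt hc).trans_le hcard))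
        fun m hmN => abs_sum_mul_sub_mul_pow_le (hK c) (hm m (by omega)) (hm (m + 1) (by omega))
    have hdiff : (y b - y a) * ∑ i with y i ≤ t, s i
        = ∑ i with y i ≤ t, s i * (y i - y a) - ∑ i with y i ≤ t, s i * (y i - y b) := by
      rw [Finset.mul_sum, ← Finset.sum_sub_distrib]
      exact Finset.sum_congr rfl fun i _ => by ring
    have hmul : g * |∑ i with y i ≤ t, s i| ≤ 2 * (δ * K * (2 * K / g) ^ N) := calc
      g * |∑ i with y i ≤ t, s i| ≤ (y b - y a) * |∑ i with y i ≤ t, s i| := by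
          gcongr
          exact hgap a b ha hb
      _ = |∑ i with y i ≤ t, s i * (y i - y a) - ∑ i with y i ≤ t, s i * (y i - y b)| := by
          rw [← hdiff, abs_mul, abs_of_pos (hg.trans_le (hgap a b ha hb))]
      _ ≤ 2 * (δ * K * (2 * K / g) ^ N) := by
          linarith [abs_sub (∑ i with y i ≤ t, s i * (y i - y a))
            (∑ i with y i ≤ t, s i * (y i - y b)), hstep a hsa, hstep b hsb]
    calc |∑ i with y i ≤ t, s i| ≤ 2 * (δ * K * (2 * K / g) ^ N) / g := by
          rwa [le_div_iff₀ hg, mul_comm]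
      _ = δ * (2 * K / g) ^ (N + 1) := by
          rw [pow_succ]
          ring
termination_by N

theorem mul_exp_neg_le_exp_sub_exp {R x y h : ℝ} (hx : -R ≤ x) (hh : 0 ≤ h) (hxy : x + h ≤ y) :
    h * Real.exp (-R) ≤ Real.exp y - Real.exp x := calc
  h * Real.exp (-R) ≤ h * Real.exp x := by gcongr
  _ ≤ Real.exp x * (Real.exp h - 1) := by nlinarith [Real.add_one_le_exp h, Real.exp_pos x]
  _ = Real.exp (x + h) - Real.exp x := by rw [Real.exp_add]; ring
  _ ≤ Real.exp y - Real.exp x := by gcongr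

theorem abs_sum_filter_le_of_abs_exp_moments_le {c s : ι → ℝ} {R t g δ : ℝ} {N : ℕ} (hg : 0 < g)
    (hgR : g ≤ 2 * R) (hc : ∀ i, |c i| ≤ R) (hgap : ∀ i, c i ≤ t ∨ t + g ≤ c i)
    (hcard : Fintype.card ι ≤ N + 1)
    (hm : ∀ m : ℕ, m ≤ N → |∑ i, s i * Real.exp (m * c i)| ≤ δ) :
    |∑ i with c i ≤ t, s i| ≤ δ * (2 * Real.exp R * (1 + Real.exp R) / g) ^ N := by
  have hgK : g * Real.exp (-R) ≤ 2 * (1 + Real.exp R) := calc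
    g * Real.exp (-R) ≤ 2 * R * Real.exp (-R) := by gcongr
    _ ≤ 2 * Real.exp R * Real.exp (-R) := by gcongr; linarith [Real.add_one_le_exp R]
    _ = 2 := by rw [mul_assoc, ← Real.exp_add, add_neg_cancel, Real.exp_zero, mul_one]
    _ ≤ 2 * (1 + Real.exp R) := by linarith [Real.exp_pos R]
  have hK : ∀ i, 1 + |Real.exp (c i)| ≤ 1 + Real.exp R := fun i => by
    rw [Real.abs_exp]
    gcongr
    exact le_of_abs_le (hc i)
  have hgap' : ∀ i j, Real.exp (c i) ≤ Real.exp t → Real.exp t < Real.exp (c j) →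
      g * Real.exp (-R) ≤ Real.exp (c j) - Real.exp (c i) := fun i j hi hj => by
    have hj' := (hgap j).resolve_left (Real.exp_lt_exp.1 hj).not_ge
    exact mul_exp_neg_le_exp_sub_exp (neg_le_of_abs_le (hc i)) hg.le
      (by linarith [Real.exp_le_exp.1 hi])
  have h := abs_sum_filter_le_of_abs_moments_le (by positivity) hgK hK hgap'
    ((Finset.card_le_univ _).trans hcard) (s := s)
    fun m hmN => by simpa only [← Real.exp_nat_mul] using hm m hmN
  have hconst : 2 * (1 + Real.exp R) / (g * Real.exp (-R))
      = 2 * Real.exp R * (1 + Real.exp R) / g := by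
    rw [Real.exp_neg]
    field_simp
  simpa only [Real.exp_le_exp, hconst] using h

end GapsBetweenNodes

section Comonotone

/-- The array `π` couples the weights `w` and `v`: it is a finitely supported transport plan. -/
structure IsWeightCoupling {ι κ : Type*} [Fintype ι] [Fintype κ] (w : ι → ℝ) (v : κ → ℝ)
    (π : ι → κ → ℝ) : Prop where
  nonneg : ∀ i j, 0 ≤ π i j
  row : ∀ i, ∑ j, π i j = w i
  col : ∀ j, ∑ i, π i j = v j

theorem min_mixed_difference_nonneg {a a' b b' : ℝ} (ha : a' ≤ a) (hb : b' ≤ b) :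
    0 ≤ min a b - min a' b - (min a b' - min a' b') := by
  grind

theorem sum_sub_filter_lt_eq {ι M : Type*} [Fintype ι] [LinearOrder ι] [AddCommGroup M]
    (f : Finset ι → M) {S : Finset ι} (hS : IsLowerSet (S : Set ι)) :
    ∑ i ∈ S, (f {x | x ≤ i} - f {x | x < i}) = f S - f ∅ := by
  induction S using Finset.induction_on_max with
  | empty => simp
  | insert a S hmax ih =>
    have hlt : Finset.filter (· < a) Finset.univ = S := by
      ext x
      have := @hS a x
      grind
    have hle : Finset.filter (· ≤ a) Finset.univ = insert a S := by
      ext x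
      have := @hS a x
      grind
    have hlower : IsLowerSet (S : Set ι) := fun x y hyx hx => by
      have := hS hyx (Finset.mem_insert_of_mem hx)
      grind
    rw [Finset.sum_insert fun ha => (hmax a ha).false, ih hlower, hlt, hle]
    abel

variable {ι κ : Type*} [Fintype ι] [Fintype κ]

/-- The comonotone coupling of the weights `w` and `v` on two finite chains: the masses whose
cumulative sums over `S × T` are, for initial segments `S` and `T`, the Fréchet–Hoeffding upper
bound `min (w S) (v T)`. -/
def comonotoneCoupling [LinearOrder ι] [LinearOrder κ] (w : ι → ℝ) (v : κ → ℝ) (i : ι) (j : κ) :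
    ℝ :=
  min (∑ x with x ≤ i, w x) (∑ y with y ≤ j, v y) - min (∑ x with x < i, w x) (∑ y with y ≤ j, v y)
    - (min (∑ x with x ≤ i, w x) (∑ y with y < j, v y)
      - min (∑ x with x < i, w x) (∑ y with y < j, v y))

section Chains

variable [LinearOrder ι] [LinearOrder κ] {w : ι → ℝ} {v : κ → ℝ}

theorem comonotoneCoupling_swap (i : ι) (j : κ) :
    comonotoneCoupling v w j i = comonotoneCoupling w v i j := by
  simp only [comonotoneCoupling, min_comm (∑ x with _, v x)]
  ring

theorem comonotoneCoupling_nonneg (hw : 0 ≤ w) (hv : 0 ≤ v) (i : ι) (j : κ) :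
    0 ≤ comonotoneCoupling w v i j :=
  min_mixed_difference_nonneg
    (Finset.sum_le_sum_of_subset_of_nonneg (Finset.monotone_filter_right _ fun _ _ => le_of_lt)
      fun x _ _ => hw x)
    (Finset.sum_le_sum_of_subset_of_nonneg (Finset.monotone_filter_right _ fun _ _ => le_of_lt)
      fun y _ _ => hv y)

theorem sum_comonotoneCoupling_right (hw : 0 ≤ w) {T : Finset κ} (hT : IsLowerSet (T : Set κ))
    (i : ι) :
    ∑ j ∈ T, comonotoneCoupling w v i j
      = min (∑ x with x ≤ i, w x) (∑ y ∈ T, v y) - min (∑ x with x < i, w x) (∑ y ∈ T, v y) := by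
  simp only [comonotoneCoupling]
  rw [sum_sub_filter_lt_eq (fun T => min (∑ x with x ≤ i, w x) (∑ y ∈ T, v y)
    - min (∑ x with x < i, w x) (∑ y ∈ T, v y)) hT]
  simp [Finset.sum_nonneg fun x _ => hw x]

theorem sum_sum_comonotoneCoupling (hw : 0 ≤ w) (hv : 0 ≤ v) {S : Finset ι} {T : Finset κ}
    (hS : IsLowerSet (S : Set ι)) (hT : IsLowerSet (T : Set κ)) :
    ∑ i ∈ S, ∑ j ∈ T, comonotoneCoupling w v i j = min (∑ x ∈ S, w x) (∑ y ∈ T, v y) := by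
  simp only [sum_comonotoneCoupling_right hw hT]
  rw [sum_sub_filter_lt_eq (fun S => min (∑ x ∈ S, w x) (∑ y ∈ T, v y)) hS]
  simp [Finset.sum_nonneg fun y _ => hv y]

theorem sum_comonotoneCoupling_univ (hw : 0 ≤ w) (hwv : ∑ i, w i ≤ ∑ j, v j) (i : ι) :
    ∑ j, comonotoneCoupling w v i j = w i := by
  have hle : ∀ S : Finset ι, ∑ x ∈ S, w x ≤ ∑ y, v y := fun S =>
    (Finset.sum_le_univ_sum_of_nonneg hw).trans hwv
  have hinsert : Finset.filter (· ≤ i) Finset.univ = insert i (Finset.filter (· < i) .univ) := by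
    grind
  rw [sum_comonotoneCoupling_right hw (by simp [isLowerSet_univ]), min_eq_left (hle _),
    min_eq_left (hle _), hinsert, Finset.sum_insert (by simp), add_sub_cancel_right]

theorem isWeightCoupling_comonotoneCoupling (hw : 0 ≤ w) (hv : 0 ≤ v)
    (hwv : ∑ i, w i = ∑ j, v j) : IsWeightCoupling w v (comonotoneCoupling w v) where
  nonneg := comonotoneCoupling_nonneg hw hv
  row := sum_comonotoneCoupling_univ hw hwv.le
  col j := by
    simp only [← comonotoneCoupling_swap (w := w)]
    exact sum_comonotoneCoupling_univ hv hwv.ge j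

end Chains

theorem IsWeightCoupling.sum_mul_abs_indicator_sub {w : ι → ℝ} {v : κ → ℝ} {π : ι → κ → ℝ}
    (h : IsWeightCoupling w v π) (p : ι → Prop) (q : κ → Prop) [DecidablePred p]
    [DecidablePred q] :
    ∑ i, ∑ j, π i j * |(if p i then (1 : ℝ) else 0) - if q j then 1 else 0|
      = ∑ i with p i, w i + ∑ j with q j, v j - 2 * ∑ i with p i, ∑ j with q j, π i j := by
  have hterm : ∀ i j, π i j * |(if p i then (1 : ℝ) else 0) - if q j then 1 else 0|
      = (if p i then π i j else 0) + (if q j then π i j else 0)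
        - 2 * if p i then if q j then π i j else 0 else 0 := fun i j => by
    split_ifs <;> grind
  have hp : ∑ i, ∑ j, (if p i then π i j else 0) = ∑ i with p i, w i := by
    rw [Finset.sum_filter]
    refine Finset.sum_congr rfl fun i _ => ?_
    split_ifs <;> simp [h.row]
  have hq : ∑ i, ∑ j, (if q j then π i j else 0) = ∑ j with q j, v j := by
    rw [Finset.sum_comm, Finset.sum_filter]
    refine Finset.sum_congr rfl fun j _ => ?_
    split_ifs <;> simp [h.col]
  have hpq : ∑ i, ∑ j, (if p i then if q j then π i j else 0 else 0)
      = ∑ i with p i, ∑ j with q j, π i j := by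
    simp only [Finset.sum_filter]
    refine Finset.sum_congr rfl fun i _ => ?_
    split_ifs <;> simp
  simp only [hterm, Finset.sum_sub_distrib, Finset.sum_add_distrib, ← Finset.mul_sum, hp, hq, hpq]

theorem exists_linearOrder_monotone {ι β : Type*} [Finite ι] [LinearOrder β] (a : ι → β) :
    ∃ _ : LinearOrder ι, Monotone a :=
  let f (i : ι) : β ×ₗ Fin (Nat.card ι) := toLex (a i, Finite.equivFin ι i)
  have hf : Function.Injective f := fun _ _ h =>
    (Finite.equivFin ι).injective (congrArg (fun x => (ofLex x).2) h)
  ⟨LinearOrder.lift' f hf, fun _ _ h => Prod.Lex.monotone_fst _ _ h⟩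

theorem exists_coupling_sum_mul_abs_indicator_sub_eq (a : ι → ℝ) (b : κ → ℝ) {w : ι → ℝ}
    {v : κ → ℝ} (hw : 0 ≤ w) (hv : 0 ≤ v) (hwv : ∑ i, w i = ∑ j, v j) :
    ∃ π, IsWeightCoupling w v π ∧ ∀ t,
      ∑ i, ∑ j, π i j * |(if a i ≤ t then (1 : ℝ) else 0) - if b j ≤ t then 1 else 0|
        = |∑ i with a i ≤ t, w i - ∑ j with b j ≤ t, v j| := by
  obtain ⟨_, ha⟩ := exists_linearOrder_monotone a
  obtain ⟨_, hb⟩ := exists_linearOrder_monotone b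
  have hπ := isWeightCoupling_comonotoneCoupling hw hv hwv
  refine ⟨_, hπ, fun t => ?_⟩
  have hS : IsLowerSet (({i | a i ≤ t} : Finset ι) : Set ι) := fun x y hyx hx => by
    simp only [Finset.coe_filter, Set.mem_ofPred_eq] at hx ⊢
    exact ⟨Finset.mem_univ _, (ha hyx).trans hx.2⟩
  have hT : IsLowerSet (({j | b j ≤ t} : Finset κ) : Set κ) := fun x y hyx hx => by
    simp only [Finset.coe_filter, Set.mem_ofPred_eq] at hx ⊢
    exact ⟨Finset.mem_univ _, (hb hyx).trans hx.2⟩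
  rw [hπ.sum_mul_abs_indicator_sub, sum_sum_comonotoneCoupling hw hv hS hT]
  grind

theorem abs_sub_le_sum_gaps {z : ℕ → ℝ} (hz : Monotone z) {M p q : ℕ} (hp : p ≤ M) (hq : q ≤ M) :
    |z p - z q| ≤ ∑ r ∈ Finset.range M, (z (r + 1) - z r) *
      |(if z p ≤ z r then (1 : ℝ) else 0) - if z q ≤ z r then 1 else 0| := by
  wlog hpq : p ≤ q generalizing p q
  · simpa only [abs_sub_comm] using this hq hp (le_of_not_ge hpq)
  have hnonneg : ∀ r, 0 ≤ z (r + 1) - z r := fun r => sub_nonneg.2 (hz r.le_succ)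
  calc |z p - z q| = ∑ r ∈ Finset.Ico p q, (z (r + 1) - z r) := by
        rw [Finset.sum_Ico_sub z hpq, abs_sub_comm, abs_of_nonneg (sub_nonneg.2 (hz hpq))]
    _ ≤ ∑ r ∈ Finset.Ico p q, (z (r + 1) - z r) *
      |(if z p ≤ z r then (1 : ℝ) else 0) - if z q ≤ z r then 1 else 0| := by
        refine Finset.sum_le_sum fun r hr => ?_
        obtain ⟨hpr, hrq⟩ := Finset.mem_Ico.1 hr
        have : z (r + 1) ≤ z q := hz hrq
        rw [if_pos (hz hpr)]
        split_ifs with hqr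
        · simpa using this.trans hqr
        · simp
    _ ≤ _ := Finset.sum_le_sum_of_subset_of_nonneg
        (fun r hr => Finset.mem_range.2 ((Finset.mem_Ico.1 hr).2.trans_le hq))
        fun r _ _ => mul_nonneg (hnonneg r) (abs_nonneg _)

theorem exists_monotone_enumeration {ι : Type*} [Fintype ι] [Nonempty ι] (f : ι → ℝ) :
    ∃ z : ℕ → ℝ, Monotone z ∧ (∀ r, z r ∈ Set.range f) ∧ ∀ i, ∃ p < Fintype.card ι, f i = z p := by
  let e := Fintype.equivFin ι
  let σ := Tuple.sort (f ∘ e.symm)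
  have hlt : ∀ r, min r (Fintype.card ι - 1) < Fintype.card ι := fun r => by
    have := Fintype.card_pos (α := ι)
    omega
  refine ⟨fun r => f (e.symm (σ ⟨_, hlt r⟩)), fun r s hrs => ?_, fun r => Set.mem_range_self _,
    fun i => ⟨σ.symm (e i), Fin.is_lt _, ?_⟩⟩
  · exact Tuple.monotone_sort (f ∘ e.symm) (Fin.mk_le_mk.2 (by omega))
  · have hi : (⟨_, hlt (σ.symm (e i))⟩ : Fin (Fintype.card ι)) = σ.symm (e i) :=
      Fin.ext (min_eq_left (Nat.le_sub_one_of_lt (Fin.is_lt _)))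
    simp only [hi, Equiv.apply_symm_apply, Equiv.symm_apply_apply]

variable {a w : ι → ℝ} {b v : κ → ℝ} {R : ℝ}

theorem exists_coupling_of_gap_bound [Nonempty (ι ⊕ κ)] {T : ℝ} (ha : ∀ i, |a i| ≤ R)
    (hb : ∀ j, |b j| ≤ R) (hw : 0 ≤ w) (hv : 0 ≤ v) (hwv : ∑ i, w i = ∑ j, v j) (hT : 0 ≤ T)
    (hgap : ∀ t g, 0 < g → g ≤ 2 * R →
      (∀ x, Sum.elim a b x ≤ t ∨ t + g ≤ Sum.elim a b x) →
      g * |∑ i with a i ≤ t, w i - ∑ j with b j ≤ t, v j| ≤ T) :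
    ∃ π, IsWeightCoupling w v π ∧
      ∑ i, ∑ j, π i j * |a i - b j| ≤ Fintype.card (ι ⊕ κ) * T := by
  obtain ⟨π, hπ, hsep⟩ := exists_coupling_sum_mul_abs_indicator_sub_eq a b hw hv hwv
  obtain ⟨z, hz, hzf, hfz⟩ := exists_monotone_enumeration (Sum.elim a b)
  set M := Fintype.card (ι ⊕ κ)
  have hzR : ∀ r, |z r| ≤ R := fun r => by
    obtain ⟨x | x, hx⟩ := hzf r <;> rw [← hx]
    exacts [ha x, hb x]
  have hsplit : ∀ r x, Sum.elim a b x ≤ z r ∨ z r + (z (r + 1) - z r) ≤ Sum.elim a b x := by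
    intro r x
    obtain ⟨p, -, hp⟩ := hfz x
    rw [hp, add_sub_cancel]
    exact (le_or_gt p r).imp (fun h => hz h) fun h => hz h
  have hbound : ∀ r, (z (r + 1) - z r) *
      |∑ i with a i ≤ z r, w i - ∑ j with b j ≤ z r, v j| ≤ T := by
    intro r
    rcases (sub_nonneg.2 (hz r.le_succ)).eq_or_lt with h0 | h0
    · rwa [← h0, zero_mul]
    · exact hgap (z r) _ h0 (by linarith [abs_le.1 (hzR r), abs_le.1 (hzR (r + 1))]) (hsplit r)
  refine ⟨π, hπ, ?_⟩
  calc ∑ i, ∑ j, π i j * |a i - b j|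
      ≤ ∑ i, ∑ j, π i j * ∑ r ∈ Finset.range M, (z (r + 1) - z r) *
        |(if a i ≤ z r then (1 : ℝ) else 0) - if b j ≤ z r then 1 else 0| := by
        gcongr with i _ j _
        · exact hπ.nonneg i j
        obtain ⟨p, hp, hap : a i = z p⟩ := hfz (Sum.inl i)
        obtain ⟨q, hq, hbq : b j = z q⟩ := hfz (Sum.inr j)
        rw [hap, hbq]
        exact abs_sub_le_sum_gaps hz hp.le hq.le
    _ = ∑ r ∈ Finset.range M, (z (r + 1) - z r) * ∑ i, ∑ j, π i j *
        |(if a i ≤ z r then (1 : ℝ) else 0) - if b j ≤ z r then 1 else 0| := by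
        simp only [Finset.mul_sum, mul_left_comm (π _ _)]
        rw [Finset.sum_comm_cycle]
    _ ≤ ∑ _r ∈ Finset.range M, T := Finset.sum_le_sum fun r _ => by
        rw [hsep]
        exact hbound r
    _ = M * T := by rw [Finset.sum_const, Finset.card_range, nsmul_eq_mul]

theorem mul_le_mul_rpow_of_le_mul_div_pow {x g δ L : ℝ} {N : ℕ} (hN : N ≠ 0) (hx : 0 ≤ x)
    (hx1 : x ≤ 1) (hg : 0 < g) (hL : 0 ≤ L) (hδ : 0 ≤ δ) (h : x ≤ δ * (L / g) ^ N) :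
    g * x ≤ L * δ ^ (1 / (N : ℝ)) := by
  refine le_of_pow_le_pow_left₀ hN (by positivity) ?_
  calc (g * x) ^ N ≤ g ^ N * (δ * (L / g) ^ N) := by
        rw [mul_pow]
        gcongr
        exact (pow_le_of_le_one hx hx1 hN).trans h
    _ = (L * δ ^ (1 / (N : ℝ))) ^ N := by
        rw [mul_pow, one_div, Real.rpow_inv_natCast_pow hδ hN, div_pow]
        field_simp

theorem abs_sum_filter_sub_sum_filter_le_one (hw : w ∈ stdSimplex ℝ ι) (hv : v ∈ stdSimplex ℝ κ)
    (p : ι → Prop) (q : κ → Prop) [DecidablePred p] [DecidablePred q] :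
    |∑ i with p i, w i - ∑ j with q j, v j| ≤ 1 := by
  have hw1 : ∑ i with p i, w i ≤ 1 := (Finset.sum_le_univ_sum_of_nonneg hw.1).trans_eq hw.2
  have hv1 : ∑ j with q j, v j ≤ 1 := (Finset.sum_le_univ_sum_of_nonneg hv.1).trans_eq hv.2
  exact abs_sub_le_of_nonneg_of_le (Finset.sum_nonneg fun i _ => hw.1 i) hw1
    (Finset.sum_nonneg fun j _ => hv.1 j) hv1

theorem abs_cdf_sub_le_of_exp_moments {n N : ℕ} (hn : Fintype.card (ι ⊕ κ) = n)
    (hN : n = N + 1) {t g δ : ℝ} (hg : 0 < g) (hgR : g ≤ 2 * R) (ha : ∀ i, |a i| ≤ R)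
    (hb : ∀ j, |b j| ≤ R) (hgap : ∀ x, Sum.elim a b x ≤ t ∨ t + g ≤ Sum.elim a b x)
    (hm : ∀ m : ℕ, m < n →
      |∑ i, w i * Real.exp (m / n * a i) - ∑ j, v j * Real.exp (m / n * b j)| ≤ δ) :
    |∑ i with a i ≤ t, w i - ∑ j with b j ≤ t, v j|
      ≤ δ * (2 * n * Real.exp R * (1 + Real.exp R) / g) ^ N := by
  have hn1 : (1 : ℝ) ≤ n := by rw [hN]; simp
  have hn0 : (0 : ℝ) < n := by linarith
  let c (x : ι ⊕ κ) : ℝ := Sum.elim a b x / n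
  let s : ι ⊕ κ → ℝ := Sum.elim w (-v)
  have hc : ∀ x, |c x| ≤ R := fun x => by
    rw [abs_div, abs_of_pos hn0]
    refine (div_le_self (abs_nonneg _) hn1).trans ?_
    rcases x with x | x
    exacts [ha x, hb x]
  have hgap' : ∀ x, c x ≤ t / n ∨ t / n + g / n ≤ c x := fun x => by
    rw [← add_div, div_le_div_iff_of_pos_right hn0, div_le_div_iff_of_pos_right hn0]
    exact hgap x
  have hmoment : ∀ m : ℕ, m ≤ N → |∑ x, s x * Real.exp (m * c x)| ≤ δ := fun m hmN => by
    convert hm m (by omega) using 2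
    simp [s, c, sub_eq_add_neg, mul_div_assoc', div_mul_eq_mul_div]
  have h := abs_sum_filter_le_of_abs_exp_moments_le (div_pos hg hn0)
    ((div_le_self hg.le hn1).trans hgR) hc hgap' (by omega) hmoment
  have hcdf : ∑ x with c x ≤ t / n, s x = ∑ i with a i ≤ t, w i - ∑ j with b j ≤ t, v j := by
    simp only [Finset.sum_filter, Fintype.sum_sum_type, c, s, Sum.elim_inl, Sum.elim_inr,
      div_le_div_iff_of_pos_right hn0, Pi.neg_apply, sub_eq_add_neg, ← Finset.sum_neg_distrib]
    grind
  convert hcdf ▸ h using 3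
  field_simp

theorem exists_coupling_of_exp_moments {n : ℕ} (hn : Fintype.card (ι ⊕ κ) = n) {δ : ℝ}
    (ha : ∀ i, |a i| ≤ R) (hb : ∀ j, |b j| ≤ R) (hw : w ∈ stdSimplex ℝ ι)
    (hv : v ∈ stdSimplex ℝ κ) (hm : ∀ m : ℕ, m < n →
      |∑ i, w i * Real.exp (m / n * a i) - ∑ j, v j * Real.exp (m / n * b j)| ≤ δ) :
    ∃ π, IsWeightCoupling w v π ∧ ∑ i, ∑ j, π i j * |a i - b j|
      ≤ n * (2 * n * Real.exp R * (1 + Real.exp R) * δ ^ (1 / ((n : ℝ) - 1))) := by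
  have hι : Nonempty ι := by
    by_contra! h
    simpa using hw.2
  have hκ : Nonempty κ := by
    by_contra! h
    simpa using hv.2
  obtain ⟨N, hN, hN0⟩ : ∃ N, n = N + 1 ∧ N ≠ 0 := by
    have := Fintype.card_pos (α := ι)
    have := Fintype.card_pos (α := κ)
    rw [Fintype.card_sum] at hn
    exact ⟨n - 1, by omega, by omega⟩
  have hNcast : (n : ℝ) - 1 = N := by rw [hN]; push_cast; ring
  have hδ : 0 ≤ δ := (abs_nonneg _).trans (hm 0 (by omega))
  have hgap : ∀ t g, 0 < g → g ≤ 2 * R →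
      (∀ x, Sum.elim a b x ≤ t ∨ t + g ≤ Sum.elim a b x) →
      g * |∑ i with a i ≤ t, w i - ∑ j with b j ≤ t, v j|
        ≤ 2 * n * Real.exp R * (1 + Real.exp R) * δ ^ (1 / ((n : ℝ) - 1)) := by
    intro t g hg hgR hgap
    rw [hNcast]
    exact mul_le_mul_rpow_of_le_mul_div_pow hN0 (abs_nonneg _)
      (abs_sum_filter_sub_sum_filter_le_one hw hv _ _) hg (by positivity) hδ
      (abs_cdf_sub_le_of_exp_moments hn hN hg hgR ha hb hgap hm)
  simpa only [hn] using exists_coupling_of_gap_bound ha hb hw.1 hv.1 (hw.2.trans hv.2.symm)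
    (by positivity) hgap

end Comonotone

section Hellinger

variable {α : Type*} [MeasurableSpace α]

theorem abs_integral_mul_le_sqrt_mul_sqrt {μ : Measure α} {f g : α → ℝ} (hf : MemLp f 2 μ)
    (hg : MemLp g 2 μ) :
    |∫ x, f x * g x ∂μ| ≤ √(∫ x, f x ^ 2 ∂μ) * √(∫ x, g x ^ 2 ∂μ) := by
  have h := integral_mul_norm_le_Lp_mul_Lq (μ := μ) (f := f) (g := g)
    Real.HolderConjugate.two_two (by simpa using hf) (by simpa using hg)
  simp only [Real.rpow_two, Real.norm_eq_abs, sq_abs, ← Real.sqrt_eq_rpow, ← abs_mul] at h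
  exact abs_integral_le_integral_abs.trans h

theorem sq_sqrt_sub_sqrt_le {p q : ℝ} (hp : 0 ≤ p) (hq : 0 ≤ q) : (√p - √q) ^ 2 ≤ p + q := by
  linarith [sub_sq √p √q, Real.sq_sqrt hp, Real.sq_sqrt hq,
    mul_nonneg (Real.sqrt_nonneg p) (Real.sqrt_nonneg q)]

theorem sq_sqrt_add_sqrt_le {p q : ℝ} (hp : 0 ≤ p) (hq : 0 ≤ q) :
    (√p + √q) ^ 2 ≤ 2 * (p + q) := by
  linarith [add_sq √p √q, sub_sq √p √q, Real.sq_sqrt hp, Real.sq_sqrt hq, sq_nonneg (√p - √q)]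

theorem memLp_sqrt_sub_sqrt {μ : Measure α} {p q : α → ℝ} (hp : 0 ≤ p) (hq : 0 ≤ q)
    (hpi : Integrable p μ) (hqi : Integrable q μ) : MemLp (fun x => √(p x) - √(q x)) 2 μ := by
  have hmeas : AEStronglyMeasurable (fun x => √(p x) - √(q x)) μ :=
    (Real.continuous_sqrt.comp_aestronglyMeasurable hpi.1).sub
      (Real.continuous_sqrt.comp_aestronglyMeasurable hqi.1)
  refine (memLp_two_iff_integrable_sq hmeas).2
    ((hpi.add hqi).mono' (hmeas.pow 2) (ae_of_all _ fun x => ?_))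
  rw [Real.norm_of_nonneg (sq_nonneg _)]
  exact sq_sqrt_sub_sqrt_le (hp x) (hq x)

/-- Cauchy–Schwarz for the factorization `p - q = (√p - √q) (√p + √q)`. -/
theorem abs_integral_sub_mul_le {μ : Measure α} {p q f : α → ℝ} (hp : 0 ≤ p) (hq : 0 ≤ q)
    (hpi : Integrable p μ) (hqi : Integrable q μ) (hf : AEStronglyMeasurable f μ)
    (hpf : Integrable (fun x => p x * f x ^ 2) μ) (hqf : Integrable (fun x => q x * f x ^ 2) μ) :
    |∫ x, (p x - q x) * f x ∂μ| ≤ √(∫ x, (√(p x) - √(q x)) ^ 2 ∂μ) *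
      √(2 * (∫ x, p x * f x ^ 2 ∂μ + ∫ x, q x * f x ^ 2 ∂μ)) := by
  have hle : ∀ x, ((√(p x) + √(q x)) * f x) ^ 2 ≤ 2 * (p x * f x ^ 2 + q x * f x ^ 2) := by
    intro x
    rw [mul_pow, ← add_mul, ← mul_assoc]
    exact mul_le_mul_of_nonneg_right (sq_sqrt_add_sqrt_le (hp x) (hq x)) (sq_nonneg _)
  have hmeas : AEStronglyMeasurable (fun x => (√(p x) + √(q x)) * f x) μ :=
    ((Real.continuous_sqrt.comp_aestronglyMeasurable hpi.1).add
      (Real.continuous_sqrt.comp_aestronglyMeasurable hqi.1)).mul hf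
  have hdom := (hpf.add hqf).const_mul 2
  have hsq : Integrable (fun x => ((√(p x) + √(q x)) * f x) ^ 2) μ :=
    hdom.mono' (hmeas.pow 2) (ae_of_all _ fun x => by
      rw [Real.norm_of_nonneg (sq_nonneg _)]
      exact hle x)
  have hfactor : ∀ x, (p x - q x) * f x = (√(p x) - √(q x)) * ((√(p x) + √(q x)) * f x) :=
    fun x => by linear_combination f x * (Real.sq_sqrt (hq x) - Real.sq_sqrt (hp x))
  simp only [hfactor]
  refine (abs_integral_mul_le_sqrt_mul_sqrt (memLp_sqrt_sub_sqrt hp hq hpi hqi)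
    ((memLp_two_iff_integrable_sq hmeas).2 hsq)).trans ?_
  gcongr
  rw [← integral_add hpf hqf, ← integral_const_mul]
  exact integral_mono hsq hdom hle

variable {P Q : Measure α} [IsFiniteMeasure P] [IsFiniteMeasure Q]

theorem hellinger_eq_ofReal : hellinger P Q = ENNReal.ofReal
    √(∫ x, (√(P.rnDeriv (P + Q) x).toReal - √(Q.rnDeriv (P + Q) x).toReal) ^ 2 ∂(P + Q)) := by
  have hmem := memLp_sqrt_sub_sqrt (fun x => ENNReal.toReal_nonneg)
    (fun x => ENNReal.toReal_nonneg) (Measure.integrable_toReal_rnDeriv (μ := P) (ν := P + Q))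
    (Measure.integrable_toReal_rnDeriv (μ := Q))
  rw [hellinger, ← ofReal_integral_eq_lintegral_ofReal hmem.integrable_sq
    (ae_of_all _ fun x => sq_nonneg _), ENNReal.ofReal_rpow_of_nonneg
    (integral_nonneg fun x => sq_nonneg _) (by norm_num), Real.sqrt_eq_rpow]

theorem hellinger_ne_top : hellinger P Q ≠ ⊤ := by
  rw [hellinger_eq_ofReal]
  exact ENNReal.ofReal_ne_top

theorem abs_integral_sub_integral_le_hellinger {f : α → ℝ} (hfP : MemLp f 2 P)
    (hfQ : MemLp f 2 Q) :
    |∫ x, f x ∂P - ∫ x, f x ∂Q|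
      ≤ (hellinger P Q).toReal * √(2 * (∫ x, f x ^ 2 ∂P + ∫ x, f x ^ 2 ∂Q)) := by
  have hP : P ≪ P + Q := Measure.absolutelyContinuous_of_le (Measure.le_add_right le_rfl)
  have hQ : Q ≪ P + Q := Measure.absolutelyContinuous_of_le (Measure.le_add_left le_rfl)
  have hfP1 : Integrable (fun x => (P.rnDeriv (P + Q) x).toReal * f x) (P + Q) :=
    (integrable_rnDeriv_smul_iff hP).2 (hfP.integrable one_le_two)
  have hfQ1 : Integrable (fun x => (Q.rnDeriv (P + Q) x).toReal * f x) (P + Q) :=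
    (integrable_rnDeriv_smul_iff hQ).2 (hfQ.integrable one_le_two)
  have h := abs_integral_sub_mul_le (μ := P + Q) (fun x => ENNReal.toReal_nonneg)
    (fun x => ENNReal.toReal_nonneg) Measure.integrable_toReal_rnDeriv
    Measure.integrable_toReal_rnDeriv (hfP.1.add_measure hfQ.1)
    ((integrable_rnDeriv_smul_iff hP).2 hfP.integrable_sq)
    ((integrable_rnDeriv_smul_iff hQ).2 hfQ.integrable_sq)
  have hPint : ∀ g : α → ℝ, ∫ x, (P.rnDeriv (P + Q) x).toReal * g x ∂(P + Q) = ∫ x, g x ∂P :=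
    fun g => integral_rnDeriv_smul hP
  have hQint : ∀ g : α → ℝ, ∫ x, (Q.rnDeriv (P + Q) x).toReal * g x ∂(P + Q) = ∫ x, g x ∂Q :=
    fun g => integral_rnDeriv_smul hQ
  simp only [sub_mul] at h
  rw [integral_sub hfP1 hfQ1] at h
  simp only [hPint, hQint] at h
  rwa [hellinger_eq_ofReal, ENNReal.toReal_ofReal (Real.sqrt_nonneg _)]

end Hellinger

section LaplaceTransform

variable {E : Type*} [NormedAddCommGroup E] [InnerProductSpace ℝ E] [MeasurableSpace E]

/-- The Laplace transform of a measure on an inner product space, with the sign convention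
`s ↦ ∫ exp ⟪s, x⟫ ∂Γ`. -/
noncomputable def laplaceTransform (Γ : Measure E) (s : E) : ℝ :=
  ∫ x, Real.exp (inner ℝ s x) ∂Γ

variable [BorelSpace E] [FiniteDimensional ℝ E] {Γ : Measure E} {R : ℝ}

theorem integrable_exp_inner [IsFiniteMeasure Γ] (hΓ : ∀ᵐ x ∂Γ, ‖x‖ ≤ R) (s : E) :
    Integrable (fun x => Real.exp (inner ℝ s x)) Γ := by
  refine Integrable.of_bound (by fun_prop) (Real.exp (‖s‖ * R)) ?_
  filter_upwards [hΓ] with x hx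
  rw [Real.norm_eq_abs, Real.abs_exp]
  gcongr
  exact (real_inner_le_norm s x).trans (by gcongr)

theorem laplaceTransform_le [IsProbabilityMeasure Γ] (hΓ : ∀ᵐ x ∂Γ, ‖x‖ ≤ R) (s : E) :
    laplaceTransform Γ s ≤ Real.exp (‖s‖ * R) := by
  have hle : ∀ᵐ x ∂Γ, Real.exp (inner ℝ s x) ≤ Real.exp (‖s‖ * R) := by
    filter_upwards [hΓ] with x hx
    gcongr
    exact (real_inner_le_norm s x).trans (by gcongr)
  simpa [laplaceTransform] using
    integral_mono_ae (integrable_exp_inner hΓ s) (integrable_const _) hle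

theorem map_inner_stdGaussian (s : E) :
    (stdGaussian E).map (fun x => inner ℝ s x) = gaussianReal 0 (‖s‖₊ ^ 2) := by
  have h := IsGaussian.map_eq_gaussianReal (μ := stdGaussian E) (innerSL ℝ s)
  rw [integral_strongDual_stdGaussian, variance_dual_stdGaussian, innerSL_apply_norm,
    Real.toNNReal_pow (norm_nonneg s), norm_toNNReal] at h
  exact h

theorem integrable_exp_inner_stdGaussian (s : E) :
    Integrable (fun x => Real.exp (inner ℝ s x)) (stdGaussian E) := by
  have h := integrable_exp_mul_gaussianReal (μ := 0) (v := ‖s‖₊ ^ 2) 1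
  rw [← map_inner_stdGaussian, integrable_map_measure (by fun_prop) (by fun_prop)] at h
  simpa [Function.comp_def] using h

theorem laplaceTransform_stdGaussian (s : E) :
    laplaceTransform (stdGaussian E) s = Real.exp (‖s‖ ^ 2 / 2) := by
  have h := mgf_gaussianReal (map_inner_stdGaussian s) 1
  simpa [laplaceTransform, mgf] using h

theorem integrable_exp_inner_conv_stdGaussian [IsFiniteMeasure Γ] (hΓ : ∀ᵐ x ∂Γ, ‖x‖ ≤ R) (s : E) :
    Integrable (fun x => Real.exp (inner ℝ s x)) (Γ.conv (stdGaussian E)) := by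
  rw [integrable_conv_iff (by fun_prop)]
  simp only [inner_add_right, Real.exp_add, norm_mul, Real.norm_eq_abs, Real.abs_exp,
    integral_const_mul]
  exact ⟨ae_of_all _ fun x => (integrable_exp_inner_stdGaussian s).const_mul _,
    (integrable_exp_inner hΓ s).mul_const _⟩

theorem laplaceTransform_conv_stdGaussian [IsFiniteMeasure Γ] (hΓ : ∀ᵐ x ∂Γ, ‖x‖ ≤ R) (s : E) :
    laplaceTransform (Γ.conv (stdGaussian E)) s
      = Real.exp (‖s‖ ^ 2 / 2) * laplaceTransform Γ s := by
  rw [laplaceTransform, integral_conv (integrable_exp_inner_conv_stdGaussian hΓ s)]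
  simp only [inner_add_right, Real.exp_add, integral_const_mul, integral_mul_const]
  rw [mul_comm, ← laplaceTransform_stdGaussian s]
  rfl

end LaplaceTransform

section GaussianMixture

variable {d : ℕ} {Γ Γ' : Measure (Euc d)} {R : ℝ}

instance isProbabilityMeasure_gaussMix [IsProbabilityMeasure Γ] :
    IsProbabilityMeasure (gaussMix Γ) := by
  unfold gaussMix
  infer_instance

theorem exp_inner_sq_eq {E : Type*} [NormedAddCommGroup E] [InnerProductSpace ℝ E] (s x : E) :
    Real.exp (inner ℝ s x) ^ 2 = Real.exp (inner ℝ ((2 : ℝ) • s) x) := by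
  rw [← Real.exp_nat_mul, real_inner_smul_left, Nat.cast_ofNat]

theorem memLp_exp_inner_gaussMix [IsFiniteMeasure Γ] (hΓ : ∀ᵐ x ∂Γ, ‖x‖ ≤ R) (s : Euc d) :
    MemLp (fun x => Real.exp (inner ℝ s x)) 2 (gaussMix Γ) := by
  rw [memLp_two_iff_integrable_sq (by fun_prop)]
  simp only [exp_inner_sq_eq]
  exact integrable_exp_inner_conv_stdGaussian hΓ _

theorem integral_exp_inner_sq_gaussMix_le [IsProbabilityMeasure Γ]
    (hΓ : ∀ᵐ x ∂Γ, ‖x‖ ≤ R) {s : Euc d} (hs : ‖s‖ ≤ 1) :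
    ∫ x, Real.exp (inner ℝ s x) ^ 2 ∂(gaussMix Γ)
      ≤ (Real.exp (‖s‖ ^ 2 / 2) * Real.exp (R + 1 / 2)) ^ 2 := by
  have hR : 0 ≤ R := by
    obtain ⟨x, hx⟩ := hΓ.exists
    exact (norm_nonneg x).trans hx
  calc
  _ = Real.exp (‖(2 : ℝ) • s‖ ^ 2 / 2) * laplaceTransform Γ ((2 : ℝ) • s) := by
      simp only [exp_inner_sq_eq]
      exact laplaceTransform_conv_stdGaussian hΓ _
  _ ≤ Real.exp (‖(2 : ℝ) • s‖ ^ 2 / 2) * Real.exp (‖(2 : ℝ) • s‖ * R) := by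
      gcongr
      exact laplaceTransform_le hΓ _
  _ = Real.exp (2 * ‖s‖ ^ 2 + 2 * ‖s‖ * R) := by
      rw [← Real.exp_add, norm_smul, Real.norm_ofNat]
      ring_nf
  _ ≤ Real.exp (2 * (‖s‖ ^ 2 / 2 + (R + 1 / 2))) := by
      gcongr
      nlinarith [norm_nonneg s]
  _ = (Real.exp (‖s‖ ^ 2 / 2) * Real.exp (R + 1 / 2)) ^ 2 := by
      rw [← Real.exp_add, ← Real.exp_nat_mul, Nat.cast_ofNat]

theorem abs_laplaceTransform_sub_le_hellinger [IsProbabilityMeasure Γ] [IsProbabilityMeasure Γ']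
    (hΓ : ∀ᵐ x ∂Γ, ‖x‖ ≤ R) (hΓ' : ∀ᵐ x ∂Γ', ‖x‖ ≤ R) {s : Euc d} (hs : ‖s‖ ≤ 1) :
    |laplaceTransform Γ s - laplaceTransform Γ' s|
      ≤ 2 * Real.exp (R + 1 / 2) * (hellinger (gaussMix Γ) (gaussMix Γ')).toReal := by
  set H := (hellinger (gaussMix Γ) (gaussMix Γ')).toReal
  set e := Real.exp (‖s‖ ^ 2 / 2) with he
  have hdiff : e * (laplaceTransform Γ s - laplaceTransform Γ' s)
      = ∫ x, Real.exp (inner ℝ s x) ∂(gaussMix Γ) - ∫ x, Real.exp (inner ℝ s x) ∂(gaussMix Γ') := by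
    rw [mul_sub, he, ← laplaceTransform_conv_stdGaussian hΓ,
      ← laplaceTransform_conv_stdGaussian hΓ']
    rfl
  have hle : e * |laplaceTransform Γ s - laplaceTransform Γ' s|
      ≤ e * (2 * Real.exp (R + 1 / 2) * H) := calc
    _ = |∫ x, Real.exp (inner ℝ s x) ∂(gaussMix Γ)
        - ∫ x, Real.exp (inner ℝ s x) ∂(gaussMix Γ')| := by
        rw [← hdiff, abs_mul, abs_of_pos (Real.exp_pos _)]
    _ ≤ H * √(2 * (∫ x, Real.exp (inner ℝ s x) ^ 2 ∂(gaussMix Γ)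
        + ∫ x, Real.exp (inner ℝ s x) ^ 2 ∂(gaussMix Γ'))) :=
        abs_integral_sub_integral_le_hellinger (memLp_exp_inner_gaussMix hΓ s)
          (memLp_exp_inner_gaussMix hΓ' s)
    _ ≤ H * √((2 * (e * Real.exp (R + 1 / 2))) ^ 2) := by
        refine mul_le_mul_of_nonneg_left (Real.sqrt_le_sqrt ?_) ENNReal.toReal_nonneg
        linarith [integral_exp_inner_sq_gaussMix_le hΓ hs,
          integral_exp_inner_sq_gaussMix_le hΓ' hs]
    _ = e * (2 * Real.exp (R + 1 / 2) * H) := by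
        rw [Real.sqrt_sq (by positivity)]
        ring
  exact le_of_mul_le_mul_left hle (Real.exp_pos _)

end GaussianMixture

section Atomic

variable {α : Type*} [MeasurableSpace α] {ι κ : Type*} [Fintype ι] [Fintype κ]

/-- The discrete measure `∑ i, w i • δ_(x i)`; negative weights count as zero. -/
noncomputable def atomic (w : ι → ℝ) (x : ι → α) : Measure α :=
  ∑ i, ENNReal.ofReal (w i) • Measure.dirac (x i)

theorem lintegral_atomic (w : ι → ℝ) (x : ι → α) {f : α → ℝ≥0∞} (hf : Measurable f) :
    ∫⁻ y, f y ∂(atomic w x) = ∑ i, ENNReal.ofReal (w i) * f (x i) := by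
  simp [atomic, lintegral_smul_measure, lintegral_dirac' _ hf]

theorem map_atomic {β : Type*} [MeasurableSpace β] (w : ι → ℝ) (x : ι → α) {f : α → β}
    (hf : Measurable f) : (atomic w x).map f = atomic w (fun i => f (x i)) := by
  refine Measure.ext_of_lintegral _ fun g hg => ?_
  rw [lintegral_map hg hf, lintegral_atomic w x (f := fun y => g (f y)) (hg.comp hf),
    lintegral_atomic _ _ hg]

theorem integral_atomic {F : Type*} [NormedAddCommGroup F] [NormedSpace ℝ F] [CompleteSpace F]
    {w : ι → ℝ} (hw : 0 ≤ w) (x : ι → α) {f : α → F} (hf : StronglyMeasurable f) :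
    ∫ y, f y ∂(atomic w x) = ∑ i, w i • f (x i) := by
  have hint : ∀ i ∈ Finset.univ, Integrable f (ENNReal.ofReal (w i) • Measure.dirac (x i)) :=
    fun i _ => (integrable_dirac' hf enorm_lt_top).smul_measure ENNReal.ofReal_ne_top
  rw [atomic, integral_finsetSum_measure hint]
  refine Finset.sum_congr rfl fun i _ => ?_
  rw [integral_smul_measure, integral_dirac' _ _ hf, ENNReal.toReal_ofReal (hw i)]

theorem ae_atomic_of_forall (w : ι → ℝ) {x : ι → α} {p : α → Prop}
    (hp : MeasurableSet {y | p y}) (h : ∀ i, p (x i)) : ∀ᵐ y ∂(atomic w x), p y := by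
  rw [ae_iff, atomic, Measure.finsetSum_apply]
  refine Finset.sum_eq_zero fun i _ => ?_
  rw [Measure.smul_apply, Measure.dirac_apply' (x i) (s := {y | ¬p y}) hp.compl]
  simp [h i]

theorem isProbabilityMeasure_atomic {w : ι → ℝ} (hw : w ∈ stdSimplex ℝ ι) (x : ι → α) :
    IsProbabilityMeasure (atomic w x) := by
  constructor
  rw [← lintegral_one, lintegral_atomic w x measurable_const]
  simp [← ENNReal.ofReal_sum_of_nonneg fun i _ => hw.1 i, hw.2]

theorem map_fst_atomic {β : Type*} [MeasurableSpace β] {w : ι → ℝ} {v : κ → ℝ} {π : ι → κ → ℝ}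
    (hπ : IsWeightCoupling w v π) (x : ι → α) (y : κ → β) :
    (atomic (fun p : ι × κ => π p.1 p.2) fun p => (x p.1, y p.2)).map Prod.fst = atomic w x := by
  refine Measure.ext_of_lintegral _ fun f hf => ?_
  rw [map_atomic _ _ measurable_fst, lintegral_atomic _ _ hf, lintegral_atomic _ _ hf,
    Fintype.sum_prod_type]
  simp only [← Finset.sum_mul, ← ENNReal.ofReal_sum_of_nonneg fun j _ => hπ.nonneg _ j, hπ.row]

theorem map_snd_atomic {β : Type*} [MeasurableSpace β] {w : ι → ℝ} {v : κ → ℝ} {π : ι → κ → ℝ}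
    (hπ : IsWeightCoupling w v π) (x : ι → α) (y : κ → β) :
    (atomic (fun p : ι × κ => π p.1 p.2) fun p => (x p.1, y p.2)).map Prod.snd = atomic v y := by
  refine Measure.ext_of_lintegral _ fun f hf => ?_
  rw [map_atomic _ _ measurable_snd, lintegral_atomic _ _ hf, lintegral_atomic _ _ hf,
    Fintype.sum_prod_type_right]
  simp only [← Finset.sum_mul, ← ENNReal.ofReal_sum_of_nonneg fun i _ => hπ.nonneg i _, hπ.col]

theorem laplaceTransform_atomic {E : Type*} [NormedAddCommGroup E] [InnerProductSpace ℝ E]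
    [MeasurableSpace E] [BorelSpace E] [FiniteDimensional ℝ E] {w : ι → ℝ} (hw : 0 ≤ w)
    (x : ι → E) (s : E) :
    laplaceTransform (atomic w x) s = ∑ i, w i * Real.exp (inner ℝ s (x i)) :=
  integral_atomic hw x (Measurable.stronglyMeasurable (by fun_prop))

theorem wasserstein1_atomic_le {d : ℕ} {w : ι → ℝ} {v : κ → ℝ} {π : ι → κ → ℝ}
    (hπ : IsWeightCoupling w v π) (x : ι → Euc d) (y : κ → Euc d) :
    wasserstein1 (atomic w x) (atomic v y)
      ≤ ENNReal.ofReal (∑ i, ∑ j, π i j * ‖x i - y j‖) := by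
  refine (iInf₂_le _ ⟨map_fst_atomic hπ x y, map_snd_atomic hπ x y⟩).trans_eq ?_
  rw [lintegral_atomic _ _ (by fun_prop), ← Fintype.sum_prod_type',
    ENNReal.ofReal_sum_of_nonneg fun p _ => mul_nonneg (hπ.nonneg _ _) (norm_nonneg _)]
  simp only [ENNReal.ofReal_mul (hπ.nonneg _ _), edist_dist, dist_eq_norm]

variable {k d : ℕ} {R : ℝ} {Γ : Measure (Euc d)}

theorem mem_atomicMixing_iff : Γ ∈ atomicMixing k d R ↔
    ∃ w ∈ stdSimplex ℝ (Fin k), ∃ μ : Fin k → Euc d, (∀ j, ‖μ j‖ ≤ R) ∧ Γ = atomic w μ :=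
  ⟨fun ⟨w, μ, hμ, hw, hw1, hΓ⟩ => ⟨w, ⟨hw, hw1⟩, μ, hμ, hΓ⟩,
    fun ⟨w, hw, μ, hμ, hΓ⟩ => ⟨w, μ, hμ, hw.1, hw.2, hΓ⟩⟩

theorem isProbabilityMeasure_of_mem_atomicMixing (h : Γ ∈ atomicMixing k d R) :
    IsProbabilityMeasure Γ := by
  obtain ⟨w, hw, μ, -, rfl⟩ := mem_atomicMixing_iff.1 h
  exact isProbabilityMeasure_atomic hw μ

theorem ae_norm_le_of_mem_atomicMixing (h : Γ ∈ atomicMixing k d R) : ∀ᵐ x ∂Γ, ‖x‖ ≤ R := by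
  obtain ⟨w, -, μ, hμ, rfl⟩ := mem_atomicMixing_iff.1 h
  exact ae_atomic_of_forall w (measurableSet_le measurable_norm measurable_const) hμ

end Atomic

section Direction

theorem gaussianReal_abs_le_le {v : NNReal} (hv : v ≠ 0) (c : ℝ) :
    gaussianReal 0 v {t | |t| ≤ c} ≤ ENNReal.ofReal (c / √v) := by
  have hv' : (0 : ℝ) < v := by positivity
  have hpdf : ∀ x, gaussianPDF 0 v x ≤ ENNReal.ofReal (√(2 * Real.pi * v))⁻¹ := fun x => by
    refine ENNReal.ofReal_le_ofReal (mul_le_of_le_one_right (by positivity) ?_)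
    rw [Real.exp_le_one_iff, neg_div, neg_nonpos]
    positivity
  have hset : {t : ℝ | |t| ≤ c} = Set.Icc (-c) c := by
    ext t
    simp [abs_le]
  have hpi : 2 * √v ≤ √(2 * Real.pi * v) := by
    refine Real.le_sqrt_of_sq_le ?_
    rw [mul_pow, Real.sq_sqrt hv'.le]
    nlinarith [Real.pi_gt_three]
  rcases lt_or_ge c 0 with hc | hc
  · simp [hset, Set.Icc_eq_empty (show ¬ -c ≤ c by linarith)]
  calc gaussianReal 0 v {t | |t| ≤ c}
      = ∫⁻ x in Set.Icc (-c) c, gaussianPDF 0 v x := by rw [hset, gaussianReal_apply _ hv]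
    _ ≤ ∫⁻ _ in Set.Icc (-c) c, ENNReal.ofReal (√(2 * Real.pi * v))⁻¹ := lintegral_mono hpdf
    _ = ENNReal.ofReal (2 * c / √(2 * Real.pi * v)) := by
        rw [setLIntegral_const, Real.volume_Icc, ← ENNReal.ofReal_mul (by positivity)]
        ring_nf
    _ ≤ ENNReal.ofReal (2 * c / (2 * √v)) := by gcongr
    _ = ENNReal.ofReal (c / √v) := by rw [mul_div_mul_left _ _ two_ne_zero]

variable {E : Type*} [NormedAddCommGroup E] [InnerProductSpace ℝ E] [FiniteDimensional ℝ E]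

section Gaussian

variable [MeasurableSpace E] [BorelSpace E]

theorem stdGaussian_abs_inner_le_le {s : E} (hs : s ≠ 0) (t : ℝ) :
    stdGaussian E {x | |inner ℝ s x| ≤ t * ‖s‖} ≤ ENNReal.ofReal t := by
  have h := gaussianReal_abs_le_le (v := ‖s‖₊ ^ 2) (by simpa using hs) (t * ‖s‖)
  rw [← map_inner_stdGaussian, Measure.map_apply (by fun_prop)
    (measurableSet_le (by fun_prop) (by fun_prop))] at h
  simpa [Real.sqrt_sq (norm_nonneg s), mul_div_cancel_right₀ _ (norm_ne_zero_iff.2 hs)] using h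

theorem stdGaussian_exists_abs_inner_le_le {ι : Type*} [Fintype ι] (v : ι → E) (t : ℝ) :
    stdGaussian E {x | ∃ p, v p ≠ 0 ∧ |inner ℝ (v p) x| ≤ t * ‖v p‖}
      ≤ Fintype.card ι * ENNReal.ofReal t := by
  simp only [Set.ofPred_exists]
  refine (measure_iUnion_fintype_le _ _).trans ?_
  rw [← Finset.card_univ, ← nsmul_eq_mul, ← Finset.sum_const]
  refine Finset.sum_le_sum fun p _ => ?_
  by_cases hp : v p = 0
  · simp [hp]
  · simpa [hp] using stdGaussian_abs_inner_le_le hp t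

theorem lintegral_sq_inner_stdGaussian (s : E) :
    ∫⁻ x, ENNReal.ofReal (inner ℝ s x ^ 2) ∂(stdGaussian E) = ENNReal.ofReal (‖s‖ ^ 2) := by
  have hint : Integrable (fun t : ℝ => t ^ 2) (gaussianReal 0 (‖s‖₊ ^ 2)) :=
    (memLp_id_gaussianReal 2).integrable_sq
  have hvar := variance_id_gaussianReal (μ := 0) (v := ‖s‖₊ ^ 2)
  rw [variance_eq_integral (by fun_prop)] at hvar
  simp only [id, integral_id_gaussianReal, sub_zero] at hvar
  rw [← lintegral_map (μ := stdGaussian E) (f := fun t : ℝ => ENNReal.ofReal (t ^ 2))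
    (g := fun x => inner ℝ s x) (by fun_prop) (by fun_prop), map_inner_stdGaussian,
    ← ofReal_integral_eq_lintegral_ofReal hint (ae_of_all _ fun x => sq_nonneg _), hvar]
  simp

theorem lintegral_sq_norm_stdGaussian :
    ∫⁻ x, ENNReal.ofReal (‖x‖ ^ 2) ∂(stdGaussian E) = Module.finrank ℝ E := by
  let b := stdOrthonormalBasis ℝ E
  have h : ∀ x : E, ENNReal.ofReal (‖x‖ ^ 2) = ∑ i, ENNReal.ofReal (inner ℝ (b i) x ^ 2) :=
    fun x => by
      rw [← ENNReal.ofReal_sum_of_nonneg fun i _ => sq_nonneg _, b.sum_sq_inner_right]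
  simp_rw [h]
  rw [lintegral_finsetSum _ fun i _ => by fun_prop]
  simp [lintegral_sq_inner_stdGaussian]

theorem stdGaussian_norm_ge_le [Nontrivial E] :
    stdGaussian E {x | 2 * √(Module.finrank ℝ E) ≤ ‖x‖} ≤ ENNReal.ofReal (1 / 4) := by
  have hd : (0 : ℝ) < Module.finrank ℝ E := by exact_mod_cast Module.finrank_pos
  have h := mul_meas_ge_le_lintegral (μ := stdGaussian E)
    (f := fun x => ENNReal.ofReal (‖x‖ ^ 2)) (by fun_prop)
    (ENNReal.ofReal (4 * Module.finrank ℝ E))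
  rw [lintegral_sq_norm_stdGaussian, mul_comm,
    ← ENNReal.le_div_iff_mul_le (by simp [Module.finrank_pos.ne']) (Or.inl ENNReal.ofReal_ne_top),
    ← ENNReal.ofReal_natCast, ← ENNReal.ofReal_div_of_pos (by positivity),
    div_mul_cancel_right₀ hd.ne', ← one_div] at h
  refine (measure_mono fun x hx => ?_).trans h
  refine ENNReal.ofReal_le_ofReal ?_
  calc 4 * (Module.finrank ℝ E : ℝ) = (2 * √(Module.finrank ℝ E)) ^ 2 := by
        rw [mul_pow, Real.sq_sqrt hd.le]
        norm_num
    _ ≤ ‖x‖ ^ 2 := pow_le_pow_left₀ (by positivity) hx 2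

end Gaussian

theorem exists_norm_lt_forall_lt_abs_inner [Nontrivial E] [MeasurableSpace E] [BorelSpace E]
    {ι : Type*} [Fintype ι] (v : ι → E) :
    ∃ x : E, ‖x‖ < 2 * √(Module.finrank ℝ E) ∧
      ∀ p, v p ≠ 0 → 1 / (2 * (Fintype.card ι : ℝ)) * ‖v p‖ < |inner ℝ (v p) x| := by
  set M : ℝ := (Fintype.card ι : ℝ)
  set bad : Set E := {x | ∃ p, v p ≠ 0 ∧ |inner ℝ (v p) x| ≤ 1 / (2 * M) * ‖v p‖}
    ∪ {x | 2 * √(Module.finrank ℝ E) ≤ ‖x‖}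
  have hbad : stdGaussian E bad < 1 := calc
    _ ≤ Fintype.card ι * ENNReal.ofReal (1 / (2 * M)) + ENNReal.ofReal (1 / 4) :=
        (measure_union_le _ _).trans
          (add_le_add (stdGaussian_exists_abs_inner_le_le v _) stdGaussian_norm_ge_le)
    _ = ENNReal.ofReal (M * (1 / (2 * M)) + 1 / 4) := by
        rw [← ENNReal.ofReal_natCast, ← ENNReal.ofReal_mul (by positivity),
          ← ENNReal.ofReal_add (by positivity) (by positivity)]
    _ < 1 := by
        rw [ENNReal.ofReal_lt_one, one_div, mul_inv_rev, ← mul_assoc]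
        linarith [mul_inv_le_one (a := M)]
  obtain ⟨x, hx⟩ : ∃ x, x ∉ bad := by
    by_contra! h
    simp [Set.eq_univ_of_forall h] at hbad
  exact ⟨x, by simpa [bad, and_comm] using hx⟩

theorem exists_forall_norm_le_mul_abs_inner {ι : Type*} [Fintype ι] (v : ι → E) :
    ∃ u : E, ‖u‖ ≤ 1 ∧
      ∀ p, ‖v p‖ ≤ 4 * Fintype.card ι * √(Module.finrank ℝ E) * |inner ℝ u (v p)| := by
  cases subsingleton_or_nontrivial E
  · exact ⟨0, by simp, fun p => by simp [Subsingleton.elim (v p) 0]⟩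
  let _ : MeasurableSpace E := borel E
  have : BorelSpace E := ⟨rfl⟩
  obtain ⟨x, hnorm, hinner⟩ := exists_norm_lt_forall_lt_abs_inner v
  set M : ℝ := (Fintype.card ι : ℝ)
  set r := 2 * √(Module.finrank ℝ E) with hr_def
  have hr : 0 < r := (norm_nonneg x).trans_lt hnorm
  refine ⟨r⁻¹ • x, ?_, fun p => ?_⟩
  · rw [norm_smul, norm_inv, Real.norm_of_nonneg hr.le, inv_mul_le_one₀ hr]
    exact hnorm.le
  · have hM : 0 < M := Nat.cast_pos.2 (Fintype.card_pos_iff.2 ⟨p⟩)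
    have hp : 1 / (2 * M) * ‖v p‖ ≤ |inner ℝ (v p) x| := by
      by_cases h : v p = 0
      · simp [h]
      · exact (hinner p h).le
    calc ‖v p‖ ≤ 2 * M * |inner ℝ (v p) x| := by
          rwa [one_div, inv_mul_le_iff₀ (by positivity)] at hp
      _ = 2 * M * r * |inner ℝ (r⁻¹ • x) (v p)| := by
          rw [real_inner_smul_left, abs_mul, abs_of_pos (inv_pos.2 hr), real_inner_comm]
          field_simp
      _ = 4 * M * √(Module.finrank ℝ E) * |inner ℝ (r⁻¹ • x) (v p)| := by
          rw [hr_def]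
          ring

end Direction

theorem abs_sum_mul_exp_inner_sub_le_hellinger {ι κ : Type*} [Fintype ι] [Fintype κ] {d : ℕ}
    {R : ℝ} {w : ι → ℝ} {v : κ → ℝ} {μ : ι → Euc d} {ν : κ → Euc d} {s : Euc d}
    (hw : w ∈ stdSimplex ℝ ι) (hv : v ∈ stdSimplex ℝ κ) (hμ : ∀ i, ‖μ i‖ ≤ R)
    (hν : ∀ j, ‖ν j‖ ≤ R) (hs : ‖s‖ ≤ 1) :
    |∑ i, w i * Real.exp (inner ℝ s (μ i)) - ∑ j, v j * Real.exp (inner ℝ s (ν j))|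
      ≤ 2 * Real.exp (R + 1 / 2)
        * (hellinger (gaussMix (atomic w μ)) (gaussMix (atomic v ν))).toReal := by
  have := isProbabilityMeasure_atomic hw μ
  have := isProbabilityMeasure_atomic hv ν
  have hnorm := measurableSet_le (measurable_norm (α := Euc d)) (measurable_const (a := R))
  have h := abs_laplaceTransform_sub_le_hellinger (ae_atomic_of_forall w hnorm hμ)
    (ae_atomic_of_forall v hnorm hν) hs
  simpa only [laplaceTransform_atomic hw.1, laplaceTransform_atomic hv.1] using h

theorem exists_coupling_le_hellinger {k d : ℕ} {R : ℝ} {w v : Fin k → ℝ} {μ ν : Fin k → Euc d}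
    (hw : w ∈ stdSimplex ℝ (Fin k)) (hv : v ∈ stdSimplex ℝ (Fin k))
    (hμ : ∀ j, ‖μ j‖ ≤ R) (hν : ∀ j, ‖ν j‖ ≤ R) :
    ∃ π, IsWeightCoupling w v π ∧ ∑ i, ∑ j, π i j * ‖μ i - ν j‖
      ≤ 32 * k ^ 4 * √d * (Real.exp R * (1 + Real.exp R)) * (2 * Real.exp (R + 1 / 2)
      * (hellinger (gaussMix (atomic w μ)) (gaussMix (atomic v ν))).toReal)
        ^ (1 / (2 * (k : ℝ) - 1)) := by
  obtain ⟨u, hu, hdir⟩ := exists_forall_norm_le_mul_abs_inner fun p : Fin k × Fin k =>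
    μ p.1 - ν p.2
  have hproj : ∀ x : Euc d, ‖x‖ ≤ R → |inner ℝ u x| ≤ R := fun x hx =>
    (abs_real_inner_le_norm u x).trans ((mul_le_of_le_one_left (norm_nonneg x) hu).trans hx)
  set H := (hellinger (gaussMix (atomic w μ)) (gaussMix (atomic v ν))).toReal
  have hmoment : ∀ m : ℕ, m < 2 * k →
      |∑ i, w i * Real.exp (m / (2 * k : ℕ) * inner ℝ u (μ i))
        - ∑ j, v j * Real.exp (m / (2 * k : ℕ) * inner ℝ u (ν j))|
      ≤ 2 * Real.exp (R + 1 / 2) * H := fun m hm => by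
    have hs : ‖((m : ℝ) / (2 * k : ℕ)) • u‖ ≤ 1 := by
      rw [norm_smul, Real.norm_of_nonneg (by positivity)]
      exact mul_le_one₀ (div_le_one_of_le₀ (by exact_mod_cast hm.le) (by positivity))
        (norm_nonneg _) hu
    simpa only [real_inner_smul_left]
      using abs_sum_mul_exp_inner_sub_le_hellinger hw hv hμ hν hs
  obtain ⟨π, hπ, hcost⟩ := exists_coupling_of_exp_moments (n := 2 * k) (by simp [two_mul])
    (fun i => hproj _ (hμ i)) (fun i => hproj _ (hν i)) hw hv hmoment
  refine ⟨π, hπ, ?_⟩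
  calc ∑ i, ∑ j, π i j * ‖μ i - ν j‖
      ≤ ∑ i, ∑ j, π i j * (4 * (k * k) * √d * |inner ℝ u (μ i) - inner ℝ u (ν j)|) := by
        gcongr with i _ j _
        · exact hπ.nonneg i j
        · simpa [inner_sub_right] using hdir (i, j)
    _ = 4 * (k * k) * √d * ∑ i, ∑ j, π i j * |inner ℝ u (μ i) - inner ℝ u (ν j)| := by
        simp only [Finset.mul_sum, mul_left_comm]
    _ ≤ _ := mul_le_mul_of_nonneg_left hcost (by positivity)
    _ = _ := by
        push_cast
        ring

section Measurability

variable {Ω α : Type*} [MeasurableSpace Ω] [MeasurableSpace α]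

theorem measurable_hellinger [MeasurableSpace.CountablyGenerated α] (κ η : Kernel Ω α)
    [IsFiniteKernel κ] [IsFiniteKernel η] : Measurable fun x => hellinger (κ x) (η x) := by
  have h : ∀ x, hellinger (κ x) (η x) = (∫⁻ y, ENNReal.ofReal
      ((√(κ.rnDeriv (κ + η) x y).toReal - √(η.rnDeriv (κ + η) x y).toReal) ^ 2) ∂((κ + η) x))
        ^ (1 / 2 : ℝ) := fun x => by
    rw [hellinger]
    congr 1
    refine lintegral_congr_ae ?_
    filter_upwards [Kernel.rnDeriv_eq_rnDeriv_measure (κ := κ) (η := κ + η) (a := x),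
      Kernel.rnDeriv_eq_rnDeriv_measure (κ := η) (η := κ + η) (a := x)] with y hκ hη
    rw [hκ, hη]
    rfl
  simp only [h]
  refine (Measurable.lintegral_kernel_prod_right ?_).pow_const _
  exact (((Kernel.measurable_rnDeriv κ (κ + η)).ennreal_toReal.sqrt.sub
    (Kernel.measurable_rnDeriv η (κ + η)).ennreal_toReal.sqrt).pow_const 2).ennreal_ofReal

theorem measurable_map_kernel {β : Type*} [MeasurableSpace β] (κ : Kernel Ω α) [IsSFiniteKernel κ]
    {f : Ω → α → β} (hf : Measurable (Function.uncurry f)) :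
    Measurable fun x => (κ x).map (f x) := by
  have h : ∀ x, (κ x).map (f x) = ((Kernel.id ×ₖ κ).map (Function.uncurry f)) x := fun x => by
    rw [Kernel.map_apply _ hf, Kernel.prod_apply, Kernel.id_apply, Measure.dirac_prod,
      Measure.map_map hf measurable_prodMk_left]
    rfl
  simp only [h]
  exact Kernel.measurable _

theorem measurable_gaussMix {d : ℕ} (κ : Kernel Ω (Euc d)) [IsSFiniteKernel κ] :
    Measurable fun x => gaussMix (κ x) := by
  have h : ∀ x, gaussMix (κ x)
      = ((κ ×ₖ Kernel.const Ω (stdGaussian (Euc d))).map fun p => p.1 + p.2) x := fun x => by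
    rw [Kernel.map_apply _ (by fun_prop), Kernel.prod_apply, Kernel.const_apply]
    rfl
  simp only [h]
  exact Kernel.measurable _

theorem measurable_hellinger_gaussMix {d : ℕ} (κ η : Kernel Ω (Euc d)) [IsMarkovKernel κ]
    [IsMarkovKernel η] : Measurable fun x => hellinger (gaussMix (κ x)) (gaussMix (η x)) := by
  let K : Kernel Ω (Euc d) := ⟨_, measurable_gaussMix κ⟩
  let E : Kernel Ω (Euc d) := ⟨_, measurable_gaussMix η⟩
  have : IsMarkovKernel K := ⟨fun x => isProbabilityMeasure_gaussMix⟩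
  have : IsMarkovKernel E := ⟨fun x => isProbabilityMeasure_gaussMix⟩
  exact measurable_hellinger K E

end Measurability

section Samples

variable {d : ℕ}

instance isProbabilityMeasure_sampleLaw {n : ℕ} {Γ : Measure (Euc d)} [IsProbabilityMeasure Γ] :
    IsProbabilityMeasure (sampleLaw n Γ) := by
  unfold sampleLaw
  infer_instance

theorem lintegral_rpow_le_rpow_lintegral {Ω : Type*} [MeasurableSpace Ω] {μ : Measure Ω}
    [IsProbabilityMeasure μ] {f : Ω → ℝ≥0∞} (hf : AEStronglyMeasurable f μ) {p : ℝ} (hp : 0 < p)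
    (hp1 : p ≤ 1) : ∫⁻ x, f x ^ p ∂μ ≤ (∫⁻ x, f x ∂μ) ^ p := by
  have h := eLpNorm'_le_eLpNorm'_of_exponent_le (f := f) hp hp1 μ hf
  simp only [eLpNorm', enorm_eq_self, ENNReal.rpow_one, div_one] at h
  rwa [one_div, ENNReal.rpow_inv_le_iff hp] at h

theorem map_comp_pi {ι κ α : Type*} [Fintype ι] [Fintype κ] [MeasurableSpace α] (P : Measure α)
    [IsProbabilityMeasure P] {e : κ → ι} (he : Function.Injective e) :
    (Measure.pi fun _ : ι => P).map (fun x j => x (e j)) = Measure.pi fun _ : κ => P := by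
  have hindep : iIndepFun (fun (i : ι) (x : ι → α) => x i) (Measure.pi fun _ => P) :=
    iIndepFun_pi (X := fun _ => id) fun _ => aemeasurable_id
  rw [(iIndepFun_iff_map_fun_eq_pi_map fun j => (measurable_pi_apply (e j)).aemeasurable).1
    (hindep.precomp he)]
  simp only [(measurePreserving_eval (fun _ : ι => P) _).map_eq]

theorem map_halves_sampleLaw {m N : ℕ} (h : 2 * m ≤ N) (Γ : Measure (Euc d))
    [IsProbabilityMeasure Γ] :
    (sampleLaw N Γ).map (fun X => (firstHalf h X, secondHalf h X))
      = (sampleLaw m Γ).prod (sampleLaw m Γ) := by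
  let e : Fin m ⊕ Fin m → Fin N :=
    Sum.elim (fun i => ⟨i, by omega⟩) (fun i => ⟨m + i, by omega⟩)
  have he : Function.Injective e := by
    rintro (i | i) (j | j) hij <;> simp [e, Fin.ext_iff] at hij ⊢ <;> omega
  have hsum := (measurePreserving_sumPiEquivProdPi fun _ : Fin m ⊕ Fin m => gaussMix Γ).map_eq
  rw [← map_comp_pi (gaussMix Γ) he, Measure.map_map (by fun_prop) (by fun_prop)] at hsum
  exact hsum

end Samples

section Frame

theorem map_stdGaussian_of_norm_adjoint {E F : Type*} [NormedAddCommGroup E]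
    [InnerProductSpace ℝ E] [FiniteDimensional ℝ E] [MeasurableSpace E] [BorelSpace E]
    [NormedAddCommGroup F] [InnerProductSpace ℝ F] [FiniteDimensional ℝ F] [MeasurableSpace F]
    [BorelSpace F] {L : E →L[ℝ] F} {M : F → E} (hLM : ∀ z y, inner ℝ z (L y) = inner ℝ (M z) y)
    (hM : ∀ z, ‖M z‖ = ‖z‖) : (stdGaussian E).map L = stdGaussian F := by
  apply Measure.ext_of_charFun
  ext t
  rw [charFun_apply, integral_map (by fun_prop) (by fun_prop), charFun_stdGaussian, ← hM,
    ← charFun_stdGaussian, charFun_apply]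
  simp only [real_inner_comm t, real_inner_comm (M t), hLM]

variable {d r : ℕ}

/-- `projFrame V`, that is `y ↦ Vᵀ y`, as a continuous linear map. -/
noncomputable def projFrameCLM (V : Fin r → Euc d) : Euc d →L[ℝ] Euc r :=
  (EuclideanSpace.equiv (Fin r) ℝ).symm.toContinuousLinearMap ∘L
    ContinuousLinearMap.pi fun j => innerSL ℝ (V j)

theorem measurable_projFrame :
    Measurable fun p : (Fin r → Euc d) × Euc d => projFrame p.1 p.2 := by
  unfold projFrame
  fun_prop

theorem measurable_liftFrame :
    Measurable fun p : (Fin r → Euc d) × Euc r => liftFrame p.1 p.2 := by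
  unfold liftFrame
  fun_prop

theorem inner_projFrame (V : Fin r → Euc d) (z : Euc r) (y : Euc d) :
    inner ℝ z (projFrame V y) = inner ℝ (liftFrame V z) y := by
  simp only [liftFrame, sum_inner, real_inner_smul_left]
  simp [PiLp.inner_apply (𝕜 := ℝ) z, projFrame, mul_comm]

theorem liftFrame_sub (V : Fin r → Euc d) (z z' : Euc r) :
    liftFrame V (z - z') = liftFrame V z - liftFrame V z' := by
  simp [liftFrame, sub_smul]

theorem liftFrame_mem_span (V : Fin r → Euc d) (z : Euc r) :
    liftFrame V z ∈ Submodule.span ℝ (Set.range V) :=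
  Submodule.sum_mem _ fun j _ => Submodule.smul_mem _ _ (Submodule.subset_span ⟨j, rfl⟩)

/-- The residual `y - V Vᵀ y`. For an orthonormal frame it is the component of `y` orthogonal to
the span of the frame. -/
noncomputable def frameResidual (V : Fin r → Euc d) (y : Euc d) : Euc d :=
  y - liftFrame V (projFrame V y)

theorem measurable_frameResidual :
    Measurable fun p : (Fin r → Euc d) × Euc d => frameResidual p.1 p.2 := by
  unfold frameResidual liftFrame projFrame
  fun_prop

variable {V : Fin r → Euc d} (hV : Orthonormal ℝ V)
include hV

theorem norm_liftFrame (z : Euc r) : ‖liftFrame V z‖ = ‖z‖ := by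
  rw [← sq_eq_sq₀ (norm_nonneg _) (norm_nonneg _), ← real_inner_self_eq_norm_sq, liftFrame,
    hV.inner_sum, EuclideanSpace.real_norm_sq_eq]
  simp [sq]

theorem inner_frameResidual_of_mem_span (y : Euc d) {x : Euc d}
    (hx : x ∈ Submodule.span ℝ (Set.range V)) : inner ℝ (frameResidual V y) x = 0 := by
  induction hx using Submodule.span_induction with
  | mem x hx =>
    obtain ⟨j, rfl⟩ := hx
    rw [frameResidual, inner_sub_left, liftFrame, hV.inner_left_fintype, projFrame]
    simp [real_inner_comm]
  | zero => exact inner_zero_right _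
  | add x y _ _ hx hy => rw [inner_add_right, hx, hy, add_zero]
  | smul c x _ hx => rw [real_inner_smul_right, hx, mul_zero]

theorem inner_frameResidual_self (y : Euc d) :
    inner ℝ (frameResidual V y) y = ‖frameResidual V y‖ ^ 2 := by
  have h := inner_frameResidual_of_mem_span hV y (liftFrame_mem_span V (projFrame V y))
  rw [← real_inner_self_eq_norm_sq, ← sub_eq_zero, ← inner_sub_right]
  rwa [frameResidual, sub_sub_cancel]

theorem frameResidual_eq_zero_iff {y : Euc d} :
    frameResidual V y = 0 ↔ y ∈ Submodule.span ℝ (Set.range V) := by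
  refine ⟨fun h => ?_, fun h => ?_⟩
  · rw [sub_eq_zero.1 h]
    exact liftFrame_mem_span V _
  · rw [← norm_eq_zero, ← sq_eq_zero_iff, ← inner_frameResidual_self hV,
      inner_frameResidual_of_mem_span hV y h]

theorem norm_projFrame_le (y : Euc d) : ‖projFrame V y‖ ≤ ‖y‖ := by
  rcases (norm_nonneg (projFrame V y)).eq_or_lt with h | h
  · exact h ▸ norm_nonneg y
  · refine le_of_mul_le_mul_left ?_ h
    rw [← real_inner_self_eq_norm_mul_norm, inner_projFrame, ← norm_liftFrame hV (projFrame V y)]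
    exact real_inner_le_norm _ _

theorem map_projFrame_gaussMix (Γ : Measure (Euc d)) [IsProbabilityMeasure Γ] :
    (gaussMix Γ).map (projFrame V) = gaussMix (Γ.map (projFrame V)) := by
  have h := Measure.map_conv_continuousLinearMap (μ := Γ) (ν := stdGaussian (Euc d))
    (projFrameCLM V)
  rwa [map_stdGaussian_of_norm_adjoint (inner_projFrame V) (norm_liftFrame hV)] at h

theorem map_projFrame_sampleLaw (m : ℕ) (Γ : Measure (Euc d)) [IsProbabilityMeasure Γ] :
    (sampleLaw m Γ).map (fun x i => projFrame V (x i)) = sampleLaw m (Γ.map (projFrame V)) := by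
  have hm : AEMeasurable (projFrame V) (gaussMix Γ) :=
    (projFrameCLM V).continuous.measurable.aemeasurable
  have : IsProbabilityMeasure ((gaussMix Γ).map (projFrame V)) :=
    Measure.isProbabilityMeasure_map hm
  rw [sampleLaw, Measure.pi_map_pi fun _ => hm, map_projFrame_gaussMix hV, sampleLaw]

end Frame

section MeasurableFrame

theorem orthonormal_snoc {E : Type*} [NormedAddCommGroup E] [InnerProductSpace ℝ E] {s : ℕ}
    {V : Fin s → E} (hV : Orthonormal ℝ V) {u : E} (hu : ‖u‖ = 1)
    (huV : ∀ i, inner ℝ u (V i) = 0) : Orthonormal ℝ (Fin.snoc V u : Fin (s + 1) → E) := by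
  refine ⟨fun i => ?_, fun i j hij => ?_⟩
  · induction i using Fin.lastCases with
    | last => simpa using hu
    | cast i => simpa using hV.1 i
  · induction i using Fin.lastCases with
    | last =>
      induction j using Fin.lastCases with
      | last => exact absurd rfl hij
      | cast j => simpa using huV j
    | cast i =>
      induction j using Fin.lastCases with
      | last => simpa [real_inner_comm] using huV i
      | cast j => simpa using hV.2 fun h => hij (congrArg _ h)

theorem span_range_snoc {E : Type*} [AddCommGroup E] [Module ℝ E] {s : ℕ} (V : Fin s → E) (u : E) :
    Submodule.span ℝ (Set.range (Fin.snoc V u : Fin (s + 1) → E))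
      = Submodule.span ℝ (Set.range V) ⊔ Submodule.span ℝ {u} := by
  rw [Fin.range_snoc, Set.insert_eq, Submodule.span_union, sup_comm]

variable {Ω : Type*} [MeasurableSpace Ω] {d : ℕ} {c : ℕ → Ω → Euc d}

theorem exists_notMem_span_range {s : ℕ} (hs : s < d) {v : ℕ → Euc d}
    (hv : Submodule.span ℝ (Set.range v) = ⊤) (V : Fin s → Euc d) :
    ∃ i, v i ∉ Submodule.span ℝ (Set.range V) := by
  by_contra! h
  have htop : Submodule.span ℝ (Set.range V) = ⊤ :=
    top_le_iff.1 (hv ▸ Submodule.span_le.2 (Set.range_subset_iff.2 h))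
  have hcard := finrank_range_le_card (R := ℝ) V
  rw [Set.finrank, htop, finrank_top, finrank_euclideanSpace_fin, Fintype.card_fin] at hcard
  omega

/-- One step of the Gram-Schmidt process: `N x` is the first index at which the sequence leaves the
span of the current frame. -/
theorem exists_measurable_orthonormal_extension (hc : ∀ i, Measurable (c i))
    (hspan : ∀ x, Submodule.span ℝ (Set.range fun i => c i x) = ⊤) {s : ℕ} (hs : s < d)
    {V : Ω → Fin s → Euc d} (hVm : Measurable V) (hV : ∀ x, Orthonormal ℝ (V x)) :
    ∃ u : Ω → Euc d, Measurable u ∧ (∀ x, ‖u x‖ = 1) ∧ (∀ x i, inner ℝ (u x) (V x i) = 0) ∧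
      ∃ N : Ω → ℕ, (∀ x, ∀ i < N x, c i x ∈ Submodule.span ℝ (Set.range (V x))) ∧
        ∀ x, u x ∈ Submodule.span ℝ (Set.range (V x)) ⊔ Submodule.span ℝ {c (N x) x} := by
  classical
  have hres : ∀ i, Measurable fun x => frameResidual (V x) (c i x) :=
    fun i => measurable_frameResidual.comp (hVm.prodMk (hc i))
  have hex : ∀ x, ∃ i, frameResidual (V x) (c i x) ≠ 0 := fun x => by
    simpa only [Ne, frameResidual_eq_zero_iff (hV x)]
      using exists_notMem_span_range hs (hspan x) (V x)
  let N : Ω → ℕ := fun x => Nat.find (hex x)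
  let q : Ω → Euc d := fun x => frameResidual (V x) (c (N x) x)
  have hq : Measurable q :=
    Measurable.find (p := fun i x => frameResidual (V x) (c i x) ≠ 0) hres
      (fun i => (hres i (measurableSet_singleton 0)).compl) hex
  have hq0 : ∀ x, q x ≠ 0 := fun x => Nat.find_spec (hex x)
  refine ⟨fun x => ‖q x‖⁻¹ • q x, by fun_prop, fun x => ?_, fun x i => ?_, N, fun x i hi => ?_,
    fun x => ?_⟩
  · rw [norm_smul, norm_inv, norm_norm, inv_mul_cancel₀ (norm_ne_zero_iff.2 (hq0 x))]
  · rw [real_inner_smul_left,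
      inner_frameResidual_of_mem_span (hV x) _ (Submodule.subset_span ⟨i, rfl⟩), mul_zero]
  · rw [← frameResidual_eq_zero_iff (hV x)]
    exact not_not.1 (Nat.find_min (hex x) hi)
  · exact Submodule.smul_mem _ _ (Submodule.sub_mem _
      (Submodule.mem_sup_right (Submodule.mem_span_singleton_self _))
      (Submodule.mem_sup_left (liftFrame_mem_span _ _)))

theorem exists_measurable_frame_of_seq (hc : ∀ i, Measurable (c i))
    (hspan : ∀ x, Submodule.span ℝ (Set.range fun i => c i x) = ⊤) {s : ℕ} (hs : s ≤ d) :
    ∃ V : Ω → Fin s → Euc d, Measurable V ∧ (∀ x, Orthonormal ℝ (V x)) ∧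
      ∀ x n, Submodule.span ℝ (Set.range (V x)) ≤ Submodule.span ℝ ((c · x) '' Set.Iio n) ∨
        Submodule.span ℝ ((c · x) '' Set.Iio n) ≤ Submodule.span ℝ (Set.range (V x)) := by
  induction s with
  | zero =>
    refine ⟨fun _ => Fin.elim0, measurable_const, fun x => ⟨fun i => i.elim0, fun i => i.elim0⟩,
      fun x n => Or.inl ?_⟩
    simp [Set.range_eq_empty]
  | succ s ih =>
    obtain ⟨V, hVm, hV, hVc⟩ := ih (by omega)
    obtain ⟨u, hum, hu, huV, N, hN, huN⟩ :=
      exists_measurable_orthonormal_extension hc hspan (by omega) hVm hV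
    refine ⟨fun x => Fin.snoc (V x) (u x), measurable_pi_iff.2 fun i => ?_,
      fun x => orthonormal_snoc (hV x) (hu x) (huV x), fun x n => ?_⟩
    · induction i using Fin.lastCases with
      | last => simpa only [Fin.snoc_last] using hum
      | cast i => simpa only [Fin.snoc_castSucc] using measurable_pi_iff.1 hVm i
    · rw [span_range_snoc]
      rcases le_or_gt n (N x) with hn | hn
      · refine Or.inr (le_trans (Submodule.span_le.2 ?_) le_sup_left)
        rintro _ ⟨i, hi, rfl⟩
        exact hN x i (lt_of_lt_of_le hi hn)
      · refine (hVc x n).imp (fun h => sup_le h ?_) fun h => h.trans le_sup_left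
        rw [Submodule.span_singleton_le_iff_mem]
        have hcN : c (N x) x ∈ Submodule.span ℝ ((c · x) '' Set.Iio n) :=
          Submodule.subset_span ⟨N x, hn, rfl⟩
        exact sup_le h ((Submodule.span_singleton_le_iff_mem _ _).2 hcN) (huN x)

theorem exists_measurable_frame {m : ℕ} {c : Fin m → Ω → Euc d} (hc : ∀ i, Measurable (c i))
    {r : ℕ} (hr : r ≤ d)
    (hrank : ∀ x, Module.finrank ℝ (Submodule.span ℝ (Set.range fun i => c i x)) ≤ r) :
    ∃ V : Ω → Fin r → Euc d, Measurable V ∧ (∀ x, Orthonormal ℝ (V x)) ∧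
      ∀ x, Submodule.span ℝ (Set.range fun i => c i x) ≤ Submodule.span ℝ (Set.range (V x)) := by
  let b := EuclideanSpace.basisFun (Fin d) ℝ
  -- The standard basis is appended so that the frame can be completed to length `r` whatever the
  -- rank of `c`.
  let c' : ℕ → Ω → Euc d := fun i x => if h : i < m then c ⟨i, h⟩ x else
    if h : i - m < d then b ⟨i - m, h⟩ else 0
  have hc' : ∀ i, Measurable (c' i) := fun i => by
    by_cases h : i < m
    · simpa [c', h] using hc ⟨i, h⟩
    · simp only [c', h, dite_false, measurable_const]
  have hspan : ∀ x, Submodule.span ℝ (Set.range fun i => c' i x) = ⊤ := fun x => by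
    rw [← top_le_iff, ← b.toBasis.span_eq, Submodule.span_le, Set.range_subset_iff]
    exact fun j => Submodule.subset_span ⟨m + j, by simp [c']⟩
  have himage : ∀ x, (c' · x) '' Set.Iio m = Set.range fun i => c i x := fun x => by
    ext y
    constructor
    · rintro ⟨i, hi, rfl⟩
      exact ⟨⟨i, hi⟩, by simp [c', Set.mem_Iio.1 hi]⟩
    · rintro ⟨i, rfl⟩
      exact ⟨i, i.2, by simp [c']⟩
  obtain ⟨V, hVm, hV, hVc⟩ := exists_measurable_frame_of_seq hc' hspan hr
  refine ⟨V, hVm, hV, fun x => ?_⟩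
  rw [← himage]
  refine (hVc x m).elim (fun h => (Submodule.eq_of_le_of_finrank_le h ?_).ge) id
  rw [finrank_span_eq_card (hV x).linearIndependent, Fintype.card_fin, himage]
  exact hrank x

end MeasurableFrame

section Moment

variable {d : ℕ} {Γ : Measure (Euc d)}

/-- The `i`-th column of the second moment matrix `∫ y yᵀ dΓ`. Unlike the atoms themselves, the
columns depend measurably on `Γ`; they span the same subspace as the atoms of positive weight. -/
noncomputable def momentColumn (Γ : Measure (Euc d)) (i : Fin d) : Euc d :=
  ∫ y, y i • y ∂Γ

theorem measurable_momentColumn {Ω : Type*} [MeasurableSpace Ω] (κ : Kernel Ω (Euc d))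
    [IsSFiniteKernel κ] (i : Fin d) : Measurable fun x => momentColumn (κ x) i := by
  have h : StronglyMeasurable fun p : Ω × Euc d => p.2 i • p.2 :=
    Measurable.stronglyMeasurable (by fun_prop)
  exact (h.integral_kernel_prod_right' (κ := κ)).measurable

theorem finrank_span_momentColumn_le {k : ℕ} {R : ℝ} (hΓ : Γ ∈ atomicMixing k d R) :
    Module.finrank ℝ (Submodule.span ℝ (Set.range (momentColumn Γ))) ≤ min d k := by
  obtain ⟨w, hw, μ, -, rfl⟩ := mem_atomicMixing_iff.1 hΓ
  refine le_min (by simpa using (Submodule.finrank_le _ :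
    Module.finrank ℝ (Submodule.span ℝ (Set.range (momentColumn (atomic w μ)))) ≤ _)) ?_
  have hle : Submodule.span ℝ (Set.range (momentColumn (atomic w μ)))
      ≤ Submodule.span ℝ (Set.range μ) := by
    refine Submodule.span_le.2 (Set.range_subset_iff.2 fun i => ?_)
    rw [momentColumn, integral_atomic hw.1 μ (Measurable.stronglyMeasurable (by fun_prop))]
    exact Submodule.sum_mem _ fun j _ => Submodule.smul_mem _ _ (Submodule.smul_mem _ _
      (Submodule.subset_span ⟨j, rfl⟩))
  simpa [Set.finrank] using (Submodule.finrank_mono hle).trans (finrank_range_le_card μ)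

theorem integral_sq_inner_eq_sum_momentColumn (hΓ : MemLp id 2 Γ) (u : Euc d) :
    ∫ y, inner ℝ u y ^ 2 ∂Γ = ∑ i, u i * inner ℝ u (momentColumn Γ i) := by
  have hint : ∀ i, Integrable (fun y : Euc d => y i • y) Γ := fun i =>
    memLp_one_iff_integrable.1 (hΓ.smul ((EuclideanSpace.proj (𝕜 := ℝ) i).comp_memLp' hΓ))
  simp only [momentColumn, ← integral_inner (hint _), ← integral_const_mul]
  rw [← integral_finsetSum _ fun i _ => ((hint i).const_inner u).const_mul (u i)]
  refine integral_congr_ae (ae_of_all _ fun y => ?_)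
  simp only [real_inner_smul_right, ← mul_assoc, ← Finset.sum_mul, sq]
  simp [PiLp.inner_apply, mul_comm]

theorem ae_mem_span_momentColumn (hΓ : MemLp id 2 Γ) :
    ∀ᵐ y ∂Γ, y ∈ Submodule.span ℝ (Set.range (momentColumn Γ)) := by
  set S := Submodule.span ℝ (Set.range (momentColumn Γ))
  have hzero : ∀ u ∈ Sᗮ, ∀ᵐ y ∂Γ, inner ℝ u y = 0 := fun u hu => by
    have h : ∫ y, inner ℝ u y ^ 2 ∂Γ = 0 := by
      rw [integral_sq_inner_eq_sum_momentColumn hΓ]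
      refine Finset.sum_eq_zero fun i _ => ?_
      rw [(Submodule.mem_orthogonal' S u).1 hu _ (Submodule.subset_span ⟨i, rfl⟩), mul_zero]
    have hint : Integrable (fun y => inner ℝ u y ^ 2) Γ := (hΓ.const_inner u).integrable_sq
    filter_upwards [(integral_eq_zero_iff_of_nonneg (fun y => sq_nonneg _) hint).1 h] with y hy
    simpa using hy
  obtain ⟨t, ht⟩ := IsNoetherian.noetherian Sᗮ
  have hall : ∀ᵐ y ∂Γ, ∀ u ∈ t, inner ℝ u y = 0 := (Finset.eventually_all t).2 fun u hu =>
    hzero u (ht ▸ Submodule.subset_span hu)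
  filter_upwards [hall] with y hy
  rw [← Submodule.orthogonal_orthogonal S, Submodule.mem_orthogonal, ← ht]
  intro u hu
  induction hu using Submodule.span_induction with
  | mem u hu => exact hy u hu
  | zero => exact inner_zero_left _
  | add u v _ _ hu hv => rw [inner_add_left, hu, hv, add_zero]
  | smul a u _ hu => rw [real_inner_smul_left, hu, mul_zero]

theorem exists_measurable_frame_ae_mem_span {Ω : Type*} [MeasurableSpace Ω] {k : ℕ} {R : ℝ}
    (κ : Kernel Ω (Euc d)) [IsMarkovKernel κ] (hκ : ∀ x, κ x ∈ atomicMixing k d R) :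
    ∃ V : Ω → Fin (min d k) → Euc d, Measurable V ∧ (∀ x, Orthonormal ℝ (V x)) ∧
      ∀ x, ∀ᵐ y ∂(κ x), y ∈ Submodule.span ℝ (Set.range (V x)) := by
  obtain ⟨V, hVm, hV, hspan⟩ := exists_measurable_frame (fun i => measurable_momentColumn κ i)
    (min_le_left d k) fun x => finrank_span_momentColumn_le (hκ x)
  have hmem : ∀ x, MemLp id 2 (κ x) := fun x =>
    MemLp.of_bound (by fun_prop) R (ae_norm_le_of_mem_atomicMixing (hκ x))
  exact ⟨V, hVm, hV, fun x => (ae_mem_span_momentColumn (hmem x)).mono fun y hy => hspan x hy⟩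

end Moment

section AtomicMixing

variable {k d r : ℕ} {R : ℝ} {Γ : Measure (Euc d)}

theorem pos_of_mem_atomicMixing (hΓ : Γ ∈ atomicMixing k d R) : 0 < k := by
  obtain ⟨w, hw, -⟩ := mem_atomicMixing_iff.1 hΓ
  refine Nat.pos_of_ne_zero fun hk => ?_
  subst hk
  simpa using hw.2

theorem one_div_two_mul_sub_one_mem_Ioc (hk : 0 < k) :
    1 / (2 * (k : ℝ) - 1) ∈ Set.Ioc (0 : ℝ) 1 := by
  have hk' : (1 : ℝ) ≤ k := by exact_mod_cast hk
  exact ⟨by apply div_pos <;> linarith, by rw [div_le_one] <;> linarith⟩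

theorem map_mem_atomicMixing (hΓ : Γ ∈ atomicMixing k d R) {f : Euc d → Euc r}
    (hf : Measurable f) (hfn : ∀ x, ‖f x‖ ≤ ‖x‖) : Γ.map f ∈ atomicMixing k r R := by
  obtain ⟨w, hw, μ, hμ, rfl⟩ := mem_atomicMixing_iff.1 hΓ
  exact mem_atomicMixing_iff.2
    ⟨w, hw, _, fun j => (hfn _).trans (hμ j), map_atomic w μ hf⟩

variable {V : Fin r → Euc d}

theorem map_liftFrame_mem_atomicMixing {γ : Measure (Euc r)} (hγ : γ ∈ atomicMixing k r R)
    (hV : Orthonormal ℝ V) : γ.map (liftFrame V) ∈ atomicMixing k d R :=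
  map_mem_atomicMixing hγ (measurable_liftFrame.comp measurable_prodMk_left)
    fun z => (norm_liftFrame hV z).le

theorem map_projFrame_mem_atomicMixing (hΓ : Γ ∈ atomicMixing k d R) (hV : Orthonormal ℝ V) :
    Γ.map (projFrame V) ∈ atomicMixing k r R :=
  map_mem_atomicMixing hΓ (measurable_projFrame.comp measurable_prodMk_left) (norm_projFrame_le hV)

end AtomicMixing

section StageOne

theorem two_add_sq_le_exp_add_exp_neg (x : ℝ) : 2 + x ^ 2 ≤ Real.exp x + Real.exp (-x) := by
  have hsinh : (x / 2) ^ 2 ≤ Real.sinh (x / 2) ^ 2 := by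
    rw [sq_le_sq, Real.abs_sinh]
    exact Real.self_le_sinh_iff.2 (abs_nonneg _)
  have hcosh : Real.cosh x = 1 + 2 * Real.sinh (x / 2) ^ 2 := by
    rw [← mul_div_cancel₀ x two_ne_zero, Real.cosh_two_mul, Real.cosh_sq]
    ring_nf
  rw [Real.cosh_eq] at hcosh
  linarith

theorem integral_sq_inner_le_laplaceTransform {E : Type*} [NormedAddCommGroup E]
    [InnerProductSpace ℝ E] [MeasurableSpace E] [BorelSpace E] [FiniteDimensional ℝ E]
    {Γ : Measure E} [IsProbabilityMeasure Γ] {R : ℝ} (hΓ : ∀ᵐ x ∂Γ, ‖x‖ ≤ R) (u : E) :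
    ∫ x, inner ℝ u x ^ 2 ∂Γ ≤ laplaceTransform Γ u + laplaceTransform Γ (-u) - 2 := by
  have hsq : Integrable (fun x => inner ℝ u x ^ 2) Γ :=
    ((MemLp.of_bound (f := id) (by fun_prop) R hΓ).const_inner u).integrable_sq
  rw [laplaceTransform, laplaceTransform,
    ← integral_add (integrable_exp_inner hΓ u) (integrable_exp_inner hΓ (-u)), le_sub_iff_add_le']
  calc 2 + ∫ x, inner ℝ u x ^ 2 ∂Γ = ∫ x, (2 + inner ℝ u x ^ 2) ∂Γ := by
        rw [integral_add (integrable_const 2) hsq]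
        simp
    _ ≤ _ := by
        refine integral_mono ((integrable_const 2).add hsq)
          ((integrable_exp_inner hΓ u).add (integrable_exp_inner hΓ (-u))) fun x => ?_
        simpa only [inner_neg_left] using two_add_sq_le_exp_add_exp_neg (inner ℝ u x)

variable {k d r : ℕ} {R : ℝ} {Γ Γ' : Measure (Euc d)} [IsProbabilityMeasure Γ']
  (hΓ' : ∀ᵐ x ∂Γ', ‖x‖ ≤ R)
include hΓ'

theorem integral_sq_inner_le_hellinger [IsProbabilityMeasure Γ] (hΓ : ∀ᵐ x ∂Γ, ‖x‖ ≤ R)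
    {u : Euc d} (hu : ‖u‖ ≤ 1) (huΓ' : ∀ᵐ x ∂Γ', inner ℝ u x = 0) :
    ∫ x, inner ℝ u x ^ 2 ∂Γ
      ≤ 4 * Real.exp (R + 1 / 2) * (hellinger (gaussMix Γ') (gaussMix Γ)).toReal := by
  have hone : ∀ s : Euc d, (∀ᵐ x ∂Γ', inner ℝ s x = 0) → laplaceTransform Γ' s = 1 := by
    intro s hs
    rw [laplaceTransform, integral_congr_ae (g := fun _ => 1) (hs.mono fun x hx => by simp [hx])]
    simp
  have hpos := abs_laplaceTransform_sub_le_hellinger hΓ' hΓ hu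
  have hneg := abs_laplaceTransform_sub_le_hellinger hΓ' hΓ ((norm_neg u).trans_le hu)
  rw [hone u huΓ', abs_sub_comm] at hpos
  rw [hone (-u) (huΓ'.mono fun x hx => by rw [inner_neg_left, hx, neg_zero]), abs_sub_comm] at hneg
  linarith [integral_sq_inner_le_laplaceTransform hΓ u, le_of_abs_le hpos, le_of_abs_le hneg]

variable {V : Fin r → Euc d} (hV : Orthonormal ℝ V)
  (hspan : ∀ᵐ x ∂Γ', x ∈ Submodule.span ℝ (Set.range V))
include hV hspan

theorem mul_sq_norm_frameResidual_le {w : Fin k → ℝ} (hw : w ∈ stdSimplex ℝ (Fin k))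
    {μ : Fin k → Euc d} (hμ : ∀ j, ‖μ j‖ ≤ R) (j : Fin k) :
    w j * ‖frameResidual V (μ j)‖ ^ 2 ≤ 4 * Real.exp (R + 1 / 2)
      * (hellinger (gaussMix Γ') (gaussMix (atomic w μ))).toReal := by
  have := isProbabilityMeasure_atomic hw μ
  have hbound : ∀ᵐ x ∂(atomic w μ), ‖x‖ ≤ R :=
    ae_norm_le_of_mem_atomicMixing (mem_atomicMixing_iff.2 ⟨w, hw, μ, hμ, rfl⟩)
  rcases eq_or_ne (frameResidual V (μ j)) 0 with h0 | h0
  · rw [h0, norm_zero, zero_pow two_ne_zero, mul_zero]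
    positivity
  set u := ‖frameResidual V (μ j)‖⁻¹ • frameResidual V (μ j) with hu
  have hu1 : ‖u‖ = 1 := by
    rw [hu, norm_smul, norm_inv, norm_norm, inv_mul_cancel₀ (norm_ne_zero_iff.2 h0)]
  have huV : ∀ᵐ x ∂Γ', inner ℝ u x = 0 := hspan.mono fun x hx => by
    rw [hu, real_inner_smul_left, inner_frameResidual_of_mem_span hV _ hx, mul_zero]
  have huμ : inner ℝ u (μ j) = ‖frameResidual V (μ j)‖ := by
    rw [hu, real_inner_smul_left, inner_frameResidual_self hV, sq,
      inv_mul_cancel_left₀ (norm_ne_zero_iff.2 h0)]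
  calc w j * ‖frameResidual V (μ j)‖ ^ 2
      ≤ ∑ i, w i • inner ℝ u (μ i) ^ 2 := by
        rw [← huμ]
        exact Finset.single_le_sum (f := fun i => w i * inner ℝ u (μ i) ^ 2)
          (fun i _ => mul_nonneg (hw.1 i) (sq_nonneg _)) (Finset.mem_univ j)
    _ = ∫ x, inner ℝ u x ^ 2 ∂(atomic w μ) :=
        (integral_atomic hw.1 μ (f := fun x => inner ℝ u x ^ 2)
          (Measurable.stronglyMeasurable (by fun_prop))).symm
    _ ≤ _ := integral_sq_inner_le_hellinger hΓ' hbound hu1.le huV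

theorem lintegral_enorm_frameResidual_le (hΓ : Γ ∈ atomicMixing k d R) :
    ∫⁻ y, ‖frameResidual V y‖ₑ ∂Γ ≤ ENNReal.ofReal √(4 * Real.exp (R + 1 / 2) * k)
      * hellinger (gaussMix Γ') (gaussMix Γ) ^ (1 / 2 : ℝ) := by
  obtain ⟨w, hw, μ, hμ, rfl⟩ := mem_atomicMixing_iff.1 hΓ
  have := isProbabilityMeasure_atomic hw μ
  set B := 4 * Real.exp (R + 1 / 2)
  set H := hellinger (gaussMix Γ') (gaussMix (atomic w μ))
  have hsq : (∑ j, w j * ‖frameResidual V (μ j)‖) ^ 2 ≤ B * k * H.toReal := by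
    calc (∑ j, w j * ‖frameResidual V (μ j)‖) ^ 2
        ≤ (∑ j, w j) * ∑ j, w j * ‖frameResidual V (μ j)‖ ^ 2 :=
          Finset.sum_sq_le_sum_mul_sum_of_sq_le_mul _ (fun j _ => hw.1 j)
            (fun j _ => mul_nonneg (hw.1 j) (sq_nonneg _)) (fun j _ => (by ring : _ = _).le)
      _ ≤ ∑ _j : Fin k, B * H.toReal := by
          rw [hw.2, one_mul]
          exact Finset.sum_le_sum fun j _ => mul_sq_norm_frameResidual_le hΓ' hV hspan hw hμ j
      _ = B * k * H.toReal := by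
          rw [Finset.sum_const, Finset.card_fin, nsmul_eq_mul]
          ring
  have hmeas : Measurable (frameResidual V) :=
    measurable_frameResidual.comp measurable_prodMk_left
  calc ∫⁻ y, ‖frameResidual V y‖ₑ ∂(atomic w μ)
      = ENNReal.ofReal (∑ j, w j * ‖frameResidual V (μ j)‖) := by
        rw [lintegral_atomic _ _ hmeas.enorm,
          ENNReal.ofReal_sum_of_nonneg fun j _ => mul_nonneg (hw.1 j) (norm_nonneg _)]
        simp only [ENNReal.ofReal_mul (hw.1 _), ofReal_norm]
    _ ≤ ENNReal.ofReal (√(B * k) * √H.toReal) := by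
        rw [← Real.sqrt_mul (by positivity)]
        exact ENNReal.ofReal_le_ofReal (Real.le_sqrt_of_sq_le hsq)
    _ = _ := by
        rw [ENNReal.ofReal_mul (Real.sqrt_nonneg _), Real.sqrt_eq_rpow H.toReal,
          ← ENNReal.ofReal_rpow_of_nonneg ENNReal.toReal_nonneg (by norm_num),
          ENNReal.ofReal_toReal hellinger_ne_top]

end StageOne

section StageTwo

variable {k d r : ℕ} {R : ℝ} {w v : Fin k → ℝ} {V : Fin r → Euc d} (hV : Orthonormal ℝ V)
include hV

theorem sum_mul_norm_liftFrame_sub_le {π : Fin k → Fin k → ℝ} (hπ : IsWeightCoupling v w π)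
    (ν : Fin k → Euc r) (μ : Fin k → Euc d) :
    ∑ i, ∑ j, π i j * ‖liftFrame V (ν i) - μ j‖
      ≤ ∑ j, w j * ‖frameResidual V (μ j)‖
        + ∑ i, ∑ j, π i j * ‖ν i - projFrame V (μ j)‖ := by
  have hsplit : ∀ i j, liftFrame V (ν i) - μ j
      = liftFrame V (ν i - projFrame V (μ j)) - frameResidual V (μ j) := fun i j => by
    rw [liftFrame_sub, frameResidual]
    abel
  calc ∑ i, ∑ j, π i j * ‖liftFrame V (ν i) - μ j‖
      ≤ ∑ i, ∑ j, (π i j * ‖frameResidual V (μ j)‖ + π i j * ‖ν i - projFrame V (μ j)‖) := by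
        refine Finset.sum_le_sum fun i _ => Finset.sum_le_sum fun j _ => ?_
        rw [← mul_add, hsplit, ← norm_liftFrame hV (ν i - projFrame V (μ j)), add_comm]
        exact mul_le_mul_of_nonneg_left (norm_sub_le _ _) (hπ.nonneg i j)
    _ = _ := by
        simp only [Finset.sum_add_distrib]
        rw [Finset.sum_comm]
        simp only [← Finset.sum_mul, hπ.col]

theorem wasserstein1_map_liftFrame_le {Γ : Measure (Euc d)} (hΓ : Γ ∈ atomicMixing k d R)
    {γ : Measure (Euc r)} (hγ : γ ∈ atomicMixing k r R) :
    wasserstein1 (γ.map (liftFrame V)) Γ ≤ ∫⁻ y, ‖frameResidual V y‖ₑ ∂Γ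
      + ENNReal.ofReal (32 * k ^ 4 * √r * (Real.exp R * (1 + Real.exp R)) *
          (2 * Real.exp (R + 1 / 2)) ^ (1 / (2 * (k : ℝ) - 1)))
        * hellinger (gaussMix γ) (gaussMix (Γ.map (projFrame V))) ^ (1 / (2 * (k : ℝ) - 1)) := by
  have hp := (one_div_two_mul_sub_one_mem_Ioc (pos_of_mem_atomicMixing hΓ)).1.le
  obtain ⟨w, hw, μ, hμ, rfl⟩ := mem_atomicMixing_iff.1 hΓ
  obtain ⟨v, hv, ν, hν, rfl⟩ := mem_atomicMixing_iff.1 hγ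
  obtain ⟨π, hπ, hcost⟩ := exists_coupling_le_hellinger hv hw hν
    fun j => (norm_projFrame_le hV (μ j)).trans (hμ j)
  have := isProbabilityMeasure_atomic hv ν
  have := isProbabilityMeasure_atomic hw fun j => projFrame V (μ j)
  have hlift : Measurable (liftFrame V) := measurable_liftFrame.comp measurable_prodMk_left
  have hproj : Measurable (projFrame V) := measurable_projFrame.comp measurable_prodMk_left
  have hmres : Measurable (frameResidual V) := measurable_frameResidual.comp measurable_prodMk_left
  rw [map_atomic v ν hlift, map_atomic w μ hproj, lintegral_atomic w μ hmres.enorm]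
  set H := hellinger (gaussMix (atomic v ν)) (gaussMix (atomic w fun j => projFrame V (μ j)))
  have hH : H = ENNReal.ofReal H.toReal := (ENNReal.ofReal_toReal hellinger_ne_top).symm
  have hres : ∑ j, ENNReal.ofReal (w j) * ‖frameResidual V (μ j)‖ₑ
      = ENNReal.ofReal (∑ j, w j * ‖frameResidual V (μ j)‖) := by
    rw [ENNReal.ofReal_sum_of_nonneg fun j _ => mul_nonneg (hw.1 j) (norm_nonneg _)]
    simp only [ENNReal.ofReal_mul (hw.1 _), ofReal_norm]
  rw [hH, hres, ENNReal.ofReal_rpow_of_nonneg ENNReal.toReal_nonneg hp,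
    ← ENNReal.ofReal_mul (by positivity), ← ENNReal.ofReal_add
      (Finset.sum_nonneg fun j _ => mul_nonneg (hw.1 j) (norm_nonneg _)) (by positivity)]
  refine (wasserstein1_atomic_le hπ _ _).trans (ENNReal.ofReal_le_ofReal ?_)
  refine (sum_mul_norm_liftFrame_sub_le hV hπ ν μ).trans (add_le_add_right (hcost.trans_eq ?_) _)
  rw [Real.mul_rpow (by positivity) ENNReal.toReal_nonneg, ← mul_assoc]

end StageTwo

section TwoStage

variable {k d r m N : ℕ} {R c : ℝ}

/-- A mixing estimator as a Markov kernel from samples to `ℝ^d`. -/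
noncomputable def IsMixingEstimator.kernel {n : ℕ} {G : (Fin n → Euc d) → Measure (Euc d)}
    (hG : IsMixingEstimator k d n R G) : Kernel (Fin n → Euc d) (Euc d) :=
  ⟨G, hG.measurable⟩

instance {n : ℕ} {G : (Fin n → Euc d) → Measure (Euc d)} (hG : IsMixingEstimator k d n R G) :
    IsMarkovKernel hG.kernel :=
  ⟨fun X => isProbabilityMeasure_of_mem_atomicMixing (hG.mem X)⟩

/-- The mixing estimator that computes the frame `V` from the first half of the sample, applies `F`
to the projection of the second half, and lifts the result back to `ℝ^d`. -/
noncomputable def twoStage (h : 2 * m ≤ N) (V : (Fin m → Euc d) → Fin r → Euc d)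
    (F : (Fin m → Euc r) → Measure (Euc r)) (X : Fin N → Euc d) : Measure (Euc d) :=
  (F fun i => projFrame (V (firstHalf h X)) (secondHalf h X i)).map (liftFrame (V (firstHalf h X)))

theorem measurable_firstHalf (h : 2 * m ≤ N) :
    Measurable (firstHalf h : (Fin N → Euc d) → Fin m → Euc d) := by
  unfold firstHalf
  fun_prop

theorem measurable_secondHalf (h : 2 * m ≤ N) :
    Measurable (secondHalf h : (Fin N → Euc d) → Fin m → Euc d) := by
  unfold secondHalf
  fun_prop

theorem lintegral_halves_sampleLaw (h : 2 * m ≤ N) (Γ : Measure (Euc d)) [IsProbabilityMeasure Γ]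
    {f : (Fin m → Euc d) × (Fin m → Euc d) → ℝ≥0∞} (hf : Measurable f) :
    ∫⁻ X, f (firstHalf h X, secondHalf h X) ∂(sampleLaw N Γ)
      = ∫⁻ x, ∫⁻ y, f (x, y) ∂(sampleLaw m Γ) ∂(sampleLaw m Γ) := by
  rw [← lintegral_prod f hf.aemeasurable, ← map_halves_sampleLaw h Γ,
    lintegral_map hf ((measurable_firstHalf h).prodMk (measurable_secondHalf h))]

variable {V : (Fin m → Euc d) → Fin r → Euc d} (hVm : Measurable V)
  (hV : ∀ x, Orthonormal ℝ (V x)) {F : (Fin m → Euc r) → Measure (Euc r)}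

include hVm in
theorem measurable_projFrame_sample : Measurable fun (q : (Fin m → Euc d) × (Fin m → Euc d)) i =>
    projFrame (V q.1) (q.2 i) :=
  measurable_pi_iff.2 fun i => measurable_projFrame.comp
    ((hVm.comp measurable_fst).prodMk ((measurable_pi_apply i).comp measurable_snd))

include hVm hV in
theorem isMixingEstimator_twoStage (h : 2 * m ≤ N) (hF : IsMixingEstimator k r m R F) :
    IsMixingEstimator k d N R (twoStage h V F) where
  measurable := by
    have hproj : Measurable fun X i => projFrame (V (firstHalf h X)) (secondHalf h X i) :=
      (measurable_projFrame_sample hVm).comp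
        ((measurable_firstHalf h).prodMk (measurable_secondHalf h))
    have hlift : Measurable (Function.uncurry fun X => liftFrame (V (firstHalf h X))) :=
      measurable_liftFrame.comp
        (((hVm.comp (measurable_firstHalf h)).comp measurable_fst).prodMk measurable_snd)
    exact measurable_map_kernel (hF.kernel.comap _ hproj) hlift
  mem X := map_liftFrame_mem_atomicMixing (hF.mem _) (hV _)

include hVm in
theorem measurable_hellinger_projFrame (hF : IsMixingEstimator k r m R F) (Γ : Measure (Euc d))
    [IsProbabilityMeasure Γ] : Measurable fun q : (Fin m → Euc d) × (Fin m → Euc d) =>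
      hellinger (gaussMix (F fun i => projFrame (V q.1) (q.2 i)))
        (gaussMix (Γ.map (projFrame (V q.1)))) := by
  have hf : Measurable (Function.uncurry fun q : (Fin m → Euc d) × (Fin m → Euc d) =>
      projFrame (V q.1)) :=
    measurable_projFrame.comp
      (((hVm.comp measurable_fst).comp measurable_fst).prodMk measurable_snd)
  let η : Kernel ((Fin m → Euc d) × (Fin m → Euc d)) (Euc r) :=
    ⟨_, measurable_map_kernel (Kernel.const _ Γ) hf⟩
  have : IsMarkovKernel η := ⟨fun q =>
    Measure.isProbabilityMeasure_map (hf.comp measurable_prodMk_left).aemeasurable⟩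
  exact measurable_hellinger_gaussMix (hF.kernel.comap _ (measurable_projFrame_sample hVm)) η

include hV in
theorem lintegral_enorm_frameResidual_sampleLaw_le {F : (Fin m → Euc d) → Measure (Euc d)}
    (hF : IsProperDensityEstimator k d m R c F)
    (hspan : ∀ x, ∀ᵐ y ∂(F x), y ∈ Submodule.span ℝ (Set.range (V x)))
    {Γ : Measure (Euc d)} (hΓ : Γ ∈ atomicMixing k d R) :
    ∫⁻ x, ∫⁻ y, ‖frameResidual (V x) y‖ₑ ∂Γ ∂(sampleLaw m Γ)
      ≤ ENNReal.ofReal √(4 * Real.exp (R + 1 / 2) * k)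
        * ENNReal.ofReal (c * ((d : ℝ) / m) ^ (1 / 2 : ℝ)) ^ (1 / 2 : ℝ) := by
  have := isProbabilityMeasure_of_mem_atomicMixing hΓ
  have hprob : ∀ x, IsProbabilityMeasure (F x) := fun x =>
    isProbabilityMeasure_of_mem_atomicMixing (hF.estimator.mem x)
  have hmeas : Measurable fun x => hellinger (gaussMix (F x)) (gaussMix Γ) :=
    measurable_hellinger_gaussMix hF.estimator.kernel (Kernel.const _ Γ)
  set B := ENNReal.ofReal √(4 * Real.exp (R + 1 / 2) * k)
  calc ∫⁻ x, ∫⁻ y, ‖frameResidual (V x) y‖ₑ ∂Γ ∂(sampleLaw m Γ)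
      ≤ ∫⁻ x, B * hellinger (gaussMix (F x)) (gaussMix Γ) ^ (1 / 2 : ℝ) ∂(sampleLaw m Γ) :=
        lintegral_mono fun x => lintegral_enorm_frameResidual_le
          (ae_norm_le_of_mem_atomicMixing (hF.estimator.mem x)) (hV x) (hspan x) hΓ
    _ = B * ∫⁻ x, hellinger (gaussMix (F x)) (gaussMix Γ) ^ (1 / 2 : ℝ) ∂(sampleLaw m Γ) :=
        lintegral_const_mul _ (hmeas.pow_const _)
    _ ≤ B * (∫⁻ x, hellinger (gaussMix (F x)) (gaussMix Γ) ∂(sampleLaw m Γ)) ^ (1 / 2 : ℝ) := by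
        gcongr
        exact lintegral_rpow_le_rpow_lintegral hmeas.aestronglyMeasurable (by norm_num)
          (by norm_num)
    _ ≤ _ := by
        gcongr
        exact hF.risk Γ hΓ

theorem lintegral_hellinger_projFrame_le (hF : IsProperDensityEstimator k r m R c F)
    {V : Fin r → Euc d} (hV : Orthonormal ℝ V) {Γ : Measure (Euc d)}
    (hΓ : Γ ∈ atomicMixing k d R) :
    ∫⁻ y, hellinger (gaussMix (F fun i => projFrame V (y i))) (gaussMix (Γ.map (projFrame V)))
      ∂(sampleLaw m Γ) ≤ ENNReal.ofReal (c * ((r : ℝ) / m) ^ (1 / 2 : ℝ)) := by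
  have := isProbabilityMeasure_of_mem_atomicMixing hΓ
  have hmem := map_projFrame_mem_atomicMixing hΓ hV
  have := isProbabilityMeasure_of_mem_atomicMixing hmem
  have hmeas : Measurable fun x => hellinger (gaussMix (F x)) (gaussMix (Γ.map (projFrame V))) :=
    measurable_hellinger_gaussMix hF.estimator.kernel (Kernel.const _ (Γ.map (projFrame V)))
  have hproj : Measurable fun (y : Fin m → Euc d) i => projFrame V (y i) :=
    measurable_pi_iff.2 fun i =>
      (projFrameCLM V).continuous.measurable.comp (measurable_pi_apply i)
  refine le_trans (le_of_eq ?_) (hF.risk _ hmem)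
  rw [← map_projFrame_sampleLaw hV m Γ, lintegral_map hmeas hproj]

include hVm hV in
theorem lintegral_wasserstein1_twoStage_le (h : 2 * m ≤ N)
    (hF : IsProperDensityEstimator k r m R c F) {Γ : Measure (Euc d)}
    (hΓ : Γ ∈ atomicMixing k d R) :
    ∫⁻ X, wasserstein1 (twoStage h V F X) Γ ∂(sampleLaw N Γ)
      ≤ ∫⁻ x, ∫⁻ y, ‖frameResidual (V x) y‖ₑ ∂Γ ∂(sampleLaw m Γ)
        + ENNReal.ofReal (32 * k ^ 4 * √r * (Real.exp R * (1 + Real.exp R)) *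
            (2 * Real.exp (R + 1 / 2)) ^ (1 / (2 * (k : ℝ) - 1)))
          * ENNReal.ofReal (c * ((r : ℝ) / m) ^ (1 / 2 : ℝ)) ^ (1 / (2 * (k : ℝ) - 1)) := by
  have := isProbabilityMeasure_of_mem_atomicMixing hΓ
  obtain ⟨hp0, hp1⟩ := one_div_two_mul_sub_one_mem_Ioc (pos_of_mem_atomicMixing hΓ)
  set p := 1 / (2 * (k : ℝ) - 1)
  set A := ENNReal.ofReal (32 * k ^ 4 * √r * (Real.exp R * (1 + Real.exp R)) *
    (2 * Real.exp (R + 1 / 2)) ^ p)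
  let D : (Fin m → Euc d) → ℝ≥0∞ := fun x => ∫⁻ y, ‖frameResidual (V x) y‖ₑ ∂Γ
  let H : (Fin m → Euc d) × (Fin m → Euc d) → ℝ≥0∞ := fun q =>
    hellinger (gaussMix (F fun i => projFrame (V q.1) (q.2 i)))
      (gaussMix (Γ.map (projFrame (V q.1))))
  have hD : Measurable D := (measurable_frameResidual.comp
    ((hVm.comp measurable_fst).prodMk measurable_snd)).enorm.lintegral_prod_right'
  have hH : Measurable H := measurable_hellinger_projFrame hVm hF.estimator Γ
  have hHp : ∀ x, ∫⁻ y, H (x, y) ^ p ∂(sampleLaw m Γ)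
      ≤ ENNReal.ofReal (c * ((r : ℝ) / m) ^ (1 / 2 : ℝ)) ^ p := fun x =>
    (lintegral_rpow_le_rpow_lintegral (hH.comp measurable_prodMk_left).aestronglyMeasurable
      hp0 hp1).trans (by gcongr; exact lintegral_hellinger_projFrame_le hF (hV x) hΓ)
  calc ∫⁻ X, wasserstein1 (twoStage h V F X) Γ ∂(sampleLaw N Γ)
      ≤ ∫⁻ X, (fun q => D q.1 + A * H q ^ p) (firstHalf h X, secondHalf h X) ∂(sampleLaw N Γ) :=
        lintegral_mono fun X => wasserstein1_map_liftFrame_le (hV _) hΓ (hF.estimator.mem _)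
    _ = ∫⁻ x, ∫⁻ y, (D x + A * H (x, y) ^ p) ∂(sampleLaw m Γ) ∂(sampleLaw m Γ) :=
        lintegral_halves_sampleLaw h Γ (f := fun q => D q.1 + A * H q ^ p)
          ((hD.comp measurable_fst).add ((hH.pow_const p).const_mul A))
    _ ≤ ∫⁻ x, (D x + A * ENNReal.ofReal (c * ((r : ℝ) / m) ^ (1 / 2 : ℝ)) ^ p)
          ∂(sampleLaw m Γ) := lintegral_mono fun x => by
        rw [lintegral_add_left measurable_const, lintegral_const, measure_univ, mul_one,
          lintegral_const_mul A (f := fun y => H (x, y) ^ p)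
            ((hH.comp measurable_prodMk_left).pow_const p)]
        gcongr
        exact hHp x
    _ = _ := by rw [lintegral_add_left hD, lintegral_const, measure_univ, mul_one]

theorem exists_twoStage_estimator (h : 2 * m ≤ N)
    {F : (d' : ℕ) → (Fin m → Euc d') → Measure (Euc d')}
    (hFd : IsProperDensityEstimator k d m R c (F d))
    (hFr : IsProperDensityEstimator k (min d k) m R c (F (min d k))) :
    ∃ G : (Fin N → Euc d) → Measure (Euc d), IsMixingEstimator k d N R G ∧ IsTwoStage k h F G ∧
      ∀ Γ ∈ atomicMixing k d R, ∫⁻ X, wasserstein1 (G X) Γ ∂(sampleLaw N Γ)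
        ≤ ENNReal.ofReal √(4 * Real.exp (R + 1 / 2) * k)
            * ENNReal.ofReal (c * ((d : ℝ) / m) ^ (1 / 2 : ℝ)) ^ (1 / 2 : ℝ)
          + ENNReal.ofReal (32 * k ^ 4 * √(min d k : ℕ) * (Real.exp R * (1 + Real.exp R)) *
              (2 * Real.exp (R + 1 / 2)) ^ (1 / (2 * (k : ℝ) - 1)))
            * ENNReal.ofReal (c * (((min d k : ℕ) : ℝ) / m) ^ (1 / 2 : ℝ))
              ^ (1 / (2 * (k : ℝ) - 1)) := by
  obtain ⟨V, hVm, hV, hspan⟩ :=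
    exists_measurable_frame_ae_mem_span hFd.estimator.kernel hFd.estimator.mem
  refine ⟨twoStage h V (F (min d k)), isMixingEstimator_twoStage hVm hV h hFr.estimator,
    ⟨V, hVm, hV, hspan, fun X => rfl⟩, fun Γ hΓ => ?_⟩
  refine (lintegral_wasserstein1_twoStage_le hVm hV h hFr hΓ).trans ?_
  gcongr
  exact lintegral_enorm_frameResidual_sampleLaw_le hV hFd hspan hΓ

end TwoStage

section LeCam

variable {α : Type*} [MeasurableSpace α] {P Q : Measure α}

theorem inf_ne_zero_of_absolutelyContinuous (hPQ : P ≪ Q) (hP : P ≠ 0) : P ⊓ Q ≠ 0 := fun h =>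
  hP (Measure.eq_zero_of_absolutelyContinuous_of_mutuallySingular hPQ
    (Measure.mutuallySingular_iff_disjoint.2 (disjoint_iff.2 h)))

theorem mul_inf_univ_le_lintegral_add_lintegral {f g : α → ℝ≥0∞} {b : ℝ≥0∞} (hf : Measurable f)
    (hfg : ∀ x, b ≤ f x + g x) : b * (P ⊓ Q) Set.univ ≤ ∫⁻ x, f x ∂P + ∫⁻ x, g x ∂Q :=
  calc b * (P ⊓ Q) Set.univ = ∫⁻ _, b ∂(P ⊓ Q) := (lintegral_const b).symm
    _ ≤ ∫⁻ x, (f x + g x) ∂(P ⊓ Q) := lintegral_mono hfg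
    _ = ∫⁻ x, f x ∂(P ⊓ Q) + ∫⁻ x, g x ∂(P ⊓ Q) := lintegral_add_left hf g
    _ ≤ _ := add_le_add (lintegral_mono' inf_le_left le_rfl) (lintegral_mono' inf_le_right le_rfl)

end LeCam

section LowerBound

theorem lintegral_sampleLaw_one {d : ℕ} (Γ : Measure (Euc d)) (f : (Fin 1 → Euc d) → ℝ≥0∞) :
    ∫⁻ X, f X ∂(sampleLaw 1 Γ) = ∫⁻ x, f (fun _ => x) ∂(gaussMix Γ) :=
  ((measurePreserving_funUnique (gaussMix Γ) (Fin 1)).symm _).lintegral_comp_emb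
    (MeasurableEquiv.funUnique (Fin 1) (Euc d)).symm.measurableEmbedding f |>.symm

theorem gaussMix_dirac_eq_map_gaussianReal (x : Euc 1) :
    gaussMix (Measure.dirac x) = (gaussianReal (x 0) 1).map fun t => WithLp.toLp 2 fun _ => t := by
  have hpi : (Measure.pi fun _ : Fin 1 => gaussianReal 0 1)
      = (gaussianReal 0 1).map (MeasurableEquiv.funUnique (Fin 1) ℝ).symm :=
    ((measurePreserving_funUnique (gaussianReal 0 1) (Fin 1)).symm _).map_eq.symm
  have hshift := gaussianReal_map_const_add (μ := 0) (v := 1) (x 0)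
  rw [zero_add] at hshift
  rw [gaussMix, Measure.dirac_conv, ← map_pi_eq_stdGaussian, hpi, ← hshift,
    Measure.map_map (by fun_prop) (MeasurableEquiv.measurable _),
    Measure.map_map (by fun_prop) (by fun_prop), Measure.map_map (by fun_prop) (by fun_prop)]
  congr 1
  ext t i
  simp [Subsingleton.elim i 0]

theorem gaussMix_dirac_absolutelyContinuous (x y : Euc 1) :
    gaussMix (Measure.dirac x) ≪ gaussMix (Measure.dirac y) := by
  rw [gaussMix_dirac_eq_map_gaussianReal, gaussMix_dirac_eq_map_gaussianReal]
  exact ((gaussianReal_absolutelyContinuous _ one_ne_zero).trans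
    (gaussianReal_absolutelyContinuous' _ one_ne_zero)).map (by fun_prop)

theorem dirac_mem_atomicMixing {k d : ℕ} (hk : 0 < k) {R : ℝ} {x : Euc d} (hx : ‖x‖ ≤ R) :
    Measure.dirac x ∈ atomicMixing k d R := by
  have hsum : ∑ _j : Fin k, (k : ℝ)⁻¹ = 1 := by simp [hk.ne']
  refine mem_atomicMixing_iff.2
    ⟨fun _ => (k : ℝ)⁻¹, ⟨fun _ => by positivity, hsum⟩, fun _ => x, fun _ => hx, ?_⟩
  rw [atomic, ← Finset.sum_smul, ← ENNReal.ofReal_sum_of_nonneg fun _ _ => by positivity, hsum,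
    ENNReal.ofReal_one, one_smul]

theorem exp_inner_sub_one_le_hellinger_add_hellinger {d : ℕ} {R : ℝ} {Γ : Measure (Euc d)}
    [IsProbabilityMeasure Γ] (hΓ : ∀ᵐ y ∂Γ, ‖y‖ ≤ R) {s x : Euc d} (hs : ‖s‖ ≤ 1) (hx : ‖x‖ ≤ R) :
    ENNReal.ofReal ((Real.exp (inner ℝ s x) - 1) / (2 * Real.exp (R + 1 / 2)))
      ≤ hellinger (gaussMix Γ) (gaussMix (Measure.dirac 0))
        + hellinger (gaussMix Γ) (gaussMix (Measure.dirac x)) := by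
  have hclose : ∀ a : Euc d, ‖a‖ ≤ R → |laplaceTransform Γ s - Real.exp (inner ℝ s a)|
      ≤ 2 * Real.exp (R + 1 / 2)
        * (hellinger (gaussMix Γ) (gaussMix (Measure.dirac a))).toReal := fun a ha => by
    have h :=
      abs_laplaceTransform_sub_le_hellinger hΓ (Γ' := Measure.dirac a) (by simpa using ha) hs
    rwa [laplaceTransform.eq_1 (Measure.dirac a), integral_dirac] at h
  have hzero := hclose 0 (by simpa using (norm_nonneg x).trans hx)
  rw [inner_zero_right, Real.exp_zero] at hzero
  refine ENNReal.ofReal_le_of_le_toReal ?_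
  rw [ENNReal.toReal_add hellinger_ne_top hellinger_ne_top, div_le_iff₀' (by positivity)]
  linarith [le_of_abs_le hzero, neg_le_of_abs_le (hclose x hx)]

theorem mul_inf_univ_le_two_mul_of_isProperDensityEstimator {k d : ℕ} {R c : ℝ}
    {F : (Fin 1 → Euc d) → Measure (Euc d)} (hF : IsProperDensityEstimator k d 1 R c F)
    {s x : Euc d} (hs : ‖s‖ ≤ 1) (hx : ‖x‖ ≤ R) :
    ENNReal.ofReal ((Real.exp (inner ℝ s x) - 1) / (2 * Real.exp (R + 1 / 2)))
        * (gaussMix (Measure.dirac 0) ⊓ gaussMix (Measure.dirac x)) Set.univ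
      ≤ 2 * ENNReal.ofReal (c * (d : ℝ) ^ (1 / 2 : ℝ)) := by
  have hprob : ∀ X, IsProbabilityMeasure (F X) := fun X =>
    isProbabilityMeasure_of_mem_atomicMixing (hF.estimator.mem X)
  have hk : 0 < k := pos_of_mem_atomicMixing (hF.estimator.mem 0)
  have hmeas : Measurable fun y : Euc d =>
      hellinger (gaussMix (F fun _ => y)) (gaussMix (Measure.dirac 0)) :=
    (measurable_hellinger_gaussMix hF.estimator.kernel (Kernel.const _ (Measure.dirac 0))).comp
      (measurable_pi_lambda _ fun _ => measurable_id)
  have hrisk : ∀ a : Euc d, ‖a‖ ≤ R → ∫⁻ y, hellinger (gaussMix (F fun _ => y))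
      (gaussMix (Measure.dirac a)) ∂(gaussMix (Measure.dirac a))
        ≤ ENNReal.ofReal (c * (d : ℝ) ^ (1 / 2 : ℝ)) := fun a ha => by
    simpa only [lintegral_sampleLaw_one, Nat.cast_one, div_one]
      using hF.risk _ (dirac_mem_atomicMixing hk ha)
  rw [two_mul (ENNReal.ofReal _)]
  refine (mul_inf_univ_le_lintegral_add_lintegral hmeas fun y => ?_).trans
    (add_le_add (hrisk 0 (norm_zero.trans_le ((norm_nonneg x).trans hx))) (hrisk x hx))
  exact exp_inner_sub_one_le_hellinger_add_hellinger
    (ae_norm_le_of_mem_atomicMixing (hF.estimator.mem fun _ => y)) hs hx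

theorem exists_pos_le_of_isProperDensityEstimator {R : ℝ} (hR : 0 < R) :
    ∃ c₀ > 0, ∀ (k : ℕ) (c : ℝ) (F : (Fin 1 → Euc 1) → Measure (Euc 1)),
      IsProperDensityEstimator k 1 1 R c F → c₀ ≤ c := by
  let e : Euc 1 := EuclideanSpace.single 0 1
  have he : ‖e‖ = 1 := by simp [e]
  let x : Euc 1 := R • e
  have hx : ‖x‖ = R := by rw [norm_smul, he, mul_one, Real.norm_of_nonneg hR.le]
  have hex : inner ℝ e x = R := by rw [inner_smul_right, real_inner_self_eq_norm_sq, he]; ring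
  set P := gaussMix (Measure.dirac (0 : Euc 1)) with hP
  set Q := gaussMix (Measure.dirac x) with hQ
  set b := ENNReal.ofReal ((Real.exp R - 1) / (2 * Real.exp (R + 1 / 2))) with hb
  have hb0 : b ≠ 0 := (ENNReal.ofReal_pos.2
    (div_pos (sub_pos.2 (Real.one_lt_exp_iff.2 hR)) (by positivity))).ne'
  have hPQ : (P ⊓ Q) Set.univ ≠ 0 := Measure.measure_univ_ne_zero.2
    (inf_ne_zero_of_absolutelyContinuous (gaussMix_dirac_absolutelyContinuous 0 x)
      (IsProbabilityMeasure.ne_zero P))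
  have htop : b * (P ⊓ Q) Set.univ ≠ ⊤ := ENNReal.mul_ne_top ENNReal.ofReal_ne_top
    (ne_top_of_le_ne_top (measure_ne_top P _) ((inf_le_left : P ⊓ Q ≤ P) _))
  have hpos : 0 < (b * (P ⊓ Q) Set.univ).toReal := ENNReal.toReal_pos (mul_ne_zero hb0 hPQ) htop
  refine ⟨_, half_pos hpos, fun k c F hF => ?_⟩
  have hle := mul_inf_univ_le_two_mul_of_isProperDensityEstimator hF he.le hx.le
  rw [hex, ← hb, ← hP, ← hQ, Nat.cast_one, Real.one_rpow, mul_one] at hle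
  have hmax := ENNReal.toReal_mono (by finiteness) hle
  rw [ENNReal.toReal_mul (a := 2), ENNReal.toReal_ofNat, ENNReal.toReal_ofReal'] at hmax
  rcases max_cases c 0 with ⟨h, -⟩ | ⟨h, -⟩ <;> rw [h] at hmax <;> linarith

end LowerBound

section ConstantEstimator

variable {k d n : ℕ} {R b : ℝ}

theorem wasserstein1_dirac_le (x : Euc d) (Γ : Measure (Euc d)) [IsProbabilityMeasure Γ] :
    wasserstein1 (Measure.dirac x) Γ ≤ ∫⁻ y, edist x y ∂Γ := by
  refine (iInf₂_le ((Measure.dirac x).prod Γ) ⟨by simp, by simp⟩).trans_eq ?_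
  rw [Measure.dirac_prod, lintegral_map (by fun_prop) (by fun_prop)]

theorem isMixingEstimator_dirac (hk : 0 < k) {x : Euc d} (hx : ‖x‖ ≤ R) :
    IsMixingEstimator k d n R fun _ => Measure.dirac x :=
  ⟨measurable_const, fun _ => dirac_mem_atomicMixing hk hx⟩

theorem hasW1Risk_dirac_zero (hb : R ≤ b) : HasW1Risk k d n R b fun _ => Measure.dirac 0 := by
  intro Γ hΓ
  have := isProbabilityMeasure_of_mem_atomicMixing hΓ
  rw [lintegral_const, measure_univ, mul_one]
  calc wasserstein1 (Measure.dirac 0) Γ ≤ ∫⁻ y, edist 0 y ∂Γ := wasserstein1_dirac_le 0 Γ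
    _ ≤ ∫⁻ _, ENNReal.ofReal b ∂Γ := lintegral_mono_ae <| by
        filter_upwards [ae_norm_le_of_mem_atomicMixing hΓ] with y hy
        rw [edist_dist, dist_zero_left]
        exact ENNReal.ofReal_le_ofReal (hy.trans hb)
    _ = ENNReal.ofReal b := by rw [lintegral_const, measure_univ, mul_one]

end ConstantEstimator

section Rate

variable {k d r m n : ℕ} {R c C : ℝ}

theorem div_le_three_mul_div (hm : 0 < m) (hn : 0 < n) (hmn : n ≤ 3 * m) {a : ℝ} (ha : 0 ≤ a) :
    a / m ≤ 3 * (a / n) := by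
  have hm' : (0 : ℝ) < m := by exact_mod_cast hm
  have hn' : (0 : ℝ) < n := by exact_mod_cast hn
  have hmn' : (n : ℝ) ≤ 3 * m := by exact_mod_cast hmn
  rw [← mul_div_assoc, div_le_div_iff₀ hm' hn']
  linarith [mul_le_mul_of_nonneg_left hmn' ha]

theorem sqrt_mul_rpow_half_le_mixingRate_fst (hk : 0 < k) (hm : 0 < m) (hn : 0 < n)
    (hmn : n ≤ 3 * m) (hc : 0 ≤ c) {b : ℝ} (hb : 0 ≤ b) (hC : 3 * b ≤ C) (hC1 : 1 ≤ C) :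
    √(b * k) * (c * ((d : ℝ) / m) ^ (1 / 2 : ℝ)) ^ (1 / 2 : ℝ)
      ≤ (C * k) ^ ((k : ℝ) / 2) * √c * ((d : ℝ) / n) ^ (1 / 4 : ℝ) := by
  have hk1 : (1 : ℝ) ≤ k := by exact_mod_cast hk
  have hsample : ((d : ℝ) / m) ^ (1 / 4 : ℝ) ≤ √3 * ((d : ℝ) / n) ^ (1 / 4 : ℝ) := by
    calc ((d : ℝ) / m) ^ (1 / 4 : ℝ) ≤ (3 * (d / n)) ^ (1 / 4 : ℝ) := by
          gcongr
          exact div_le_three_mul_div hm hn hmn (Nat.cast_nonneg d)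
      _ = 3 ^ (1 / 4 : ℝ) * ((d : ℝ) / n) ^ (1 / 4 : ℝ) :=
          Real.mul_rpow (by norm_num) (by positivity)
      _ ≤ _ := by
          rw [Real.sqrt_eq_rpow]
          gcongr <;> norm_num
  have hconst : √(b * k * 3) ≤ (C * k) ^ ((k : ℝ) / 2) := by
    calc √(b * k * 3) ≤ √(C * k) := Real.sqrt_le_sqrt (by
          linarith [mul_le_mul_of_nonneg_right hC (Nat.cast_nonneg (α := ℝ) k)])
      _ = (C * k) ^ (1 / 2 : ℝ) := Real.sqrt_eq_rpow _
      _ ≤ _ := Real.rpow_le_rpow_of_exponent_le (one_le_mul_of_one_le_of_one_le hC1 hk1)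
          (by linarith)
  calc √(b * k) * (c * ((d : ℝ) / m) ^ (1 / 2 : ℝ)) ^ (1 / 2 : ℝ)
      = √(b * k) * (√c * ((d : ℝ) / m) ^ (1 / 4 : ℝ)) := by
        rw [Real.mul_rpow hc (by positivity), ← Real.rpow_mul (by positivity),
          ← Real.sqrt_eq_rpow]
        norm_num
    _ ≤ √(b * k) * (√c * (√3 * ((d : ℝ) / n) ^ (1 / 4 : ℝ))) := by gcongr
    _ = √(b * k * 3) * √c * ((d : ℝ) / n) ^ (1 / 4 : ℝ) := by
        rw [Real.sqrt_mul (by positivity : 0 ≤ b * k) 3]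
        ring
    _ ≤ _ := by gcongr

theorem div_rpow_le_three_mul_sqrt_mul (hk : 0 < k) (hr : r ≤ k) (hm : 0 < m) (hn : 0 < n)
    (hmn : n ≤ 3 * m) {q : ℝ} (hq0 : 0 ≤ q) (hq : q ≤ 1 / 2) :
    ((r : ℝ) / m) ^ q ≤ 3 * (√k * (1 / (n : ℝ)) ^ q) := by
  have hk1 : (1 : ℝ) ≤ k := by exact_mod_cast hk
  have hratio : (r : ℝ) / m ≤ 3 * (k * (1 / n)) := by
    rw [mul_one_div]
    exact (by gcongr : (r : ℝ) / m ≤ k / m).trans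
      (div_le_three_mul_div hm hn hmn (Nat.cast_nonneg k))
  calc ((r : ℝ) / m) ^ q ≤ (3 * (k * (1 / n))) ^ q := by gcongr
    _ = 3 ^ q * ((k : ℝ) ^ q * (1 / (n : ℝ)) ^ q) := by
        rw [Real.mul_rpow (by norm_num) (by positivity), Real.mul_rpow (by positivity)
          (by positivity)]
    _ ≤ 3 * (√k * (1 / (n : ℝ)) ^ q) := by
        have hthree : (3 : ℝ) ^ q ≤ 3 :=
          Real.rpow_le_self_of_one_le (by norm_num) (by linarith)
        have hsqrt : (k : ℝ) ^ q ≤ √k := by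
          rw [Real.sqrt_eq_rpow]
          exact Real.rpow_le_rpow_of_exponent_le hk1 hq
        gcongr

theorem mul_rpow_le_mixingRate_snd (hk : 0 < k) (hr : r ≤ k) (hm : 0 < m) (hn : 0 < n)
    (hmn : n ≤ 3 * m) (hc : 0 ≤ c) {A B : ℝ} (hA : 0 ≤ A) (hB : 1 ≤ B) (hC : 96 * A * B ≤ C) :
    32 * k ^ 4 * √r * A * B ^ (1 / (2 * (k : ℝ) - 1))
        * (c * ((r : ℝ) / m) ^ (1 / 2 : ℝ)) ^ (1 / (2 * (k : ℝ) - 1))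
      ≤ C * (k : ℝ) ^ 5 * c ^ (1 / (2 * (k : ℝ) - 1))
        * (1 / (n : ℝ)) ^ (1 / (4 * (k : ℝ) - 2)) := by
  have : 0 < B := one_pos.trans_le hB
  obtain ⟨hp0, hp1⟩ := one_div_two_mul_sub_one_mem_Ioc hk
  have hq : 1 / (4 * (k : ℝ) - 2) = 1 / 2 * (1 / (2 * (k : ℝ) - 1)) := by
    rw [one_div_mul_one_div, mul_sub, ← mul_assoc]
    norm_num
  rw [hq]
  set p := 1 / (2 * (k : ℝ) - 1)
  have hBp : B ^ p ≤ B := Real.rpow_le_self_of_one_le hB hp1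
  have hratio := div_rpow_le_three_mul_sqrt_mul (r := r) (q := 1 / 2 * p) hk hr hm hn hmn
    (by linarith) (by linarith)
  have hrk : (r : ℝ) ≤ k := by exact_mod_cast hr
  calc 32 * k ^ 4 * √r * A * B ^ p * (c * ((r : ℝ) / m) ^ (1 / 2 : ℝ)) ^ p
      = 32 * k ^ 4 * √r * A * B ^ p * (c ^ p * ((r : ℝ) / m) ^ (1 / 2 * p)) := by
        rw [Real.mul_rpow hc (by positivity), ← Real.rpow_mul (by positivity)]
    _ ≤ 32 * k ^ 4 * √k * A * B * (c ^ p * (3 * (√k * (1 / (n : ℝ)) ^ (1 / 2 * p)))) := by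
        gcongr
    _ = 96 * A * B * (k ^ 4 * (√k * √k)) * c ^ p * (1 / (n : ℝ)) ^ (1 / 2 * p) := by ring
    _ = 96 * A * B * k ^ 5 * c ^ p * (1 / (n : ℝ)) ^ (1 / 2 * p) := by
        rw [Real.mul_self_sqrt (by positivity)]
        ring
    _ ≤ _ := by gcongr

theorem le_mixingRate_one (hk : 0 < k) {c₀ : ℝ} (hc₀ : 0 < c₀) (hcc : c₀ ≤ c) (hC0 : 0 ≤ C)
    (hC : R / min c₀ 1 ≤ C) : R ≤ mixingRate C c k d 1 := by
  have hk1 : (1 : ℝ) ≤ k := by exact_mod_cast hk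
  have hmin : 0 < min c₀ 1 := lt_min hc₀ one_pos
  obtain ⟨hp0, hp1⟩ := one_div_two_mul_sub_one_mem_Ioc hk
  rw [mixingRate, Nat.cast_one, div_one, div_one, Real.one_rpow, mul_one]
  set p := 1 / (2 * (k : ℝ) - 1)
  have hmin_le : min c₀ 1 ≤ c ^ p :=
    calc min c₀ 1 ≤ min c₀ 1 ^ p := Real.self_le_rpow_of_le_one hmin.le (min_le_right _ _) hp1
      _ ≤ c ^ p := Real.rpow_le_rpow hmin.le ((min_le_left _ _).trans hcc) hp0.le
  calc R ≤ C * min c₀ 1 := (div_le_iff₀ hmin).1 hC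
    _ ≤ C * k ^ 5 * c ^ p := mul_le_mul (le_mul_of_one_le_right hC0 (one_le_pow₀ hk1)) hmin_le
        hmin.le (by positivity)
    _ ≤ _ := le_add_of_nonneg_left (by positivity)

theorem exists_twoStage_estimator_hasW1Risk {N : ℕ} (hk : 0 < k) (hd : 0 < d) (hm : 0 < m)
    (hn : 0 < n) (hmn : n ≤ 3 * m) (h : 2 * m ≤ N) (hR : 0 ≤ R) (hc : 0 ≤ c)
    (hC : 96 * (Real.exp R * (1 + Real.exp R)) * (2 * Real.exp (R + 1 / 2)) ≤ C)
    {F : (d' : ℕ) → (Fin m → Euc d') → Measure (Euc d')}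
    (hF : ∀ d', 1 ≤ d' → IsProperDensityEstimator k d' m R c (F d')) :
    ∃ G : (Fin N → Euc d) → Measure (Euc d), IsMixingEstimator k d N R G ∧ IsTwoStage k h F G ∧
      HasW1Risk k d N R (mixingRate C c k d n) G := by
  obtain ⟨G, hG, hG2, hrisk⟩ :=
    exists_twoStage_estimator h (hF d hd) (hF (min d k) (le_min hd hk))
  refine ⟨G, hG, hG2, fun Γ hΓ => (hrisk Γ hΓ).trans ?_⟩
  have hp := (one_div_two_mul_sub_one_mem_Ioc hk).1.le
  have hA : 1 ≤ Real.exp R * (1 + Real.exp R) :=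
    one_le_mul_of_one_le_of_one_le (Real.one_le_exp hR) (by linarith [Real.exp_pos R])
  have hB : 1 ≤ Real.exp (R + 1 / 2) := Real.one_le_exp (by linarith)
  have hBC : 96 * 1 * (2 * Real.exp (R + 1 / 2)) ≤ C := le_trans (by gcongr) hC
  rw [ENNReal.ofReal_rpow_of_nonneg (by positivity) (by norm_num),
    ENNReal.ofReal_rpow_of_nonneg (by positivity) hp, ← ENNReal.ofReal_mul (by positivity),
    ← ENNReal.ofReal_mul (by positivity), ← ENNReal.ofReal_add (by positivity) (by positivity)]
  refine ENNReal.ofReal_le_ofReal (add_le_add ?_ ?_)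
  · exact sqrt_mul_rpow_half_le_mixingRate_fst hk hm hn hmn hc (by positivity) (by linarith)
      (by linarith)
  · exact mul_rpow_le_mixingRate_snd hk (min_le_right _ _) hm hn hmn hc (by positivity)
      (by linarith) hC

end Rate

theorem mainTheorem7 (R : ℝ) (hR : 0 < R) :
    ∃ C : ℝ, 0 < C ∧ ∀ (k : ℕ), 1 ≤ k → ∀ c : ℝ, 0 < c →
      -- a fixed `n`: density estimators from `n` observations, two-stage estimator from `2 n`
      (∀ n : ℕ, 1 ≤ n →
        ∀ F : (d : ℕ) → (Fin n → Euc d) → Measure (Euc d),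
          (∀ d, 1 ≤ d → IsProperDensityEstimator k d n R c (F d)) →
          ∀ d, 1 ≤ d → ∃ G : (Fin (2 * n) → Euc d) → Measure (Euc d),
            IsMixingEstimator k d (2 * n) R G ∧
            IsTwoStage k (le_refl (2 * n)) F G ∧
            HasW1Risk k d (2 * n) R (mixingRate C c k d n) G) ∧
      -- all `n`: density estimators from `n` observations, mixing estimator from `n` observations
      (∀ F : (n d : ℕ) → (Fin n → Euc d) → Measure (Euc d),
          (∀ n, 1 ≤ n → ∀ d, 1 ≤ d → IsProperDensityEstimator k d n R c (F n d)) →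
          ∀ n, 1 ≤ n → ∀ d, 1 ≤ d → ∃ G : (Fin n → Euc d) → Measure (Euc d),
            IsMixingEstimator k d n R G ∧
            (2 ≤ n → IsTwoStage k (Nat.mul_div_le n 2) (F (n / 2)) G) ∧
            HasW1Risk k d n R (mixingRate C c k d n) G) := by
  obtain ⟨c₀, hc₀, hlow⟩ := exists_pos_le_of_isProperDensityEstimator hR
  set A := 96 * (Real.exp R * (1 + Real.exp R)) * (2 * Real.exp (R + 1 / 2))
  set C := max A (R / min c₀ 1)
  have hC : 0 < C := lt_max_of_lt_left (by positivity)
  refine ⟨C, hC, fun k hk c hc => ⟨fun n hn F hF d hd => ?_, fun F hF n hn d hd => ?_⟩⟩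
  · exact exists_twoStage_estimator_hasW1Risk hk hd hn hn (by omega) le_rfl hR.le hc.le
      (le_max_left _ _) hF
  obtain rfl | hn2 := hn.eq_or_lt
  · have hcc : c₀ ≤ c := hlow k c _ (hF 1 le_rfl 1 le_rfl)
    exact ⟨fun _ => Measure.dirac 0, isMixingEstimator_dirac hk (by simpa using hR.le),
      fun h => absurd h (by omega),
      hasW1Risk_dirac_zero (le_mixingRate_one hk hc₀ hcc hC.le (le_max_right _ _))⟩
  · obtain ⟨G, hG, htwo, hrisk⟩ := exists_twoStage_estimator_hasW1Risk hk hd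
      (show 1 ≤ n / 2 by omega) hn (by omega) (Nat.mul_div_le n 2) hR.le hc.le
      (le_max_left _ _) (hF (n / 2) (by omega))
    exact ⟨G, hG, fun _ => htwo, hrisk⟩
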